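/- **Theorem 1.2.** Let $n\ge 1$ and $0<\alpha<1$. For $t>0$ let $e^{-t(-\Delta)^\alpha}$ be the fractional heat operator on $\mathbb R^n$, i.e. the Fourier multiplier operator $\mathcal F\big(e^{-t(-\Delta)^\alpha}f\big)(\xi)=e^{-t|\xi|^{2\alpha}}\mathcal F f(\xi)$, where $\mathcal F f(\xi)=\int_{\mathbb R^n}e^{-i x\cdot\xi}f(x)\,dx$; for integrable $f$, $e^{-t(-\Delta)^\alpha}f(x)$ denotes the pointwise value of the continuous function given by the inverse Fourier integral. For real sequences $v=\{v_j\}_{j\in\mathbb Z}$ and $\{a_j\}_{j\in\mathbb Z}$ with all $a_j>0$, and for $N=(N_1,N_2)\in\mathbb Z^2$ with $N_1<N_2$, put $$T_Nf(x)=\sum_{j=N_1}^{N_2}v_j\Big(e^{-a_{j+1}(-\Delta)^\alpha}f(x)-e^{-a_j(-\Delta)^\alpha}f(x)\Big),\qquad T^*f(x)=\sup_{N_1<N_2}|T_Nf(x)|\in[0,\infty].$$ There is a constant $C>0$, depending only on $n$ and $\alpha$, with the following property. Let $1\le p\le\infty$, let $p'$ be the conjugate exponent ($\frac1p+\frac1{p'}=1$;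 $p'=\infty$ if $p=1$, $p'=1$ if $p=\infty$), let $v\in\ell^p(\mathbb Z)$, and let $\{a_j\}_{j\in\mathbb Z}$ be any increasing (not necessarily strictly) sequence of positive numbers. Then for every (real- or complex-valued) $f\in L^\infty(\mathbb R^n)$ supported in the unit ball $B=B(0,1)$, that is, vanishing almost everywhere outside $B$, and every ball $B_r\subset B$ of radius $r>0$ (with arbitrary center) such that $2r<1$, $$\frac1{|B_r|}\int_{B_r}|T^*f(x)|\,dx\le C\Big(\log\frac2r\Big)^{1/p'}\|v\|_{\ell^p(\mathbb Z)}\,\|f\|_{L^\infty(\mathbb R^n)}.$$ -/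

import Mathlib

open scoped FourierTransform ENNReal
open MeasureTheory

/-- The fractional heat operator `e^{-t(-Δ)^α}` on `ℝⁿ`, defined (pointwise, for `f ∈ L¹` and `t > 0`)
as a Fourier multiplier. Since Mathlib's Fourier transform is
`𝓕 f ξ = ∫ exp (-2πi ⟪x, ξ⟫) f x dx`, for which `-Δ` is multiplication by `(2π‖ξ‖)²`, the operator
`e^{-t(-Δ)^α}` is multiplication by `exp (-t (2π‖ξ‖)^(2α))` on the Fourier side. -/
noncomputable def fracHeat {n : ℕ} (α t : ℝ) (f : EuclideanSpace ℝ (Fin n) → ℂ) :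
    EuclideanSpace ℝ (Fin n) → ℂ :=
  𝓕⁻ (fun ξ : EuclideanSpace ℝ (Fin n) =>
    (Real.exp (-t * (2 * Real.pi * ‖ξ‖) ^ (2 * α)) : ℂ) * 𝓕 f ξ)

/-- The partial sum `T_N f = ∑_{j = N₁}^{N₂} v_j (e^{-a_{j+1}(-Δ)^α} f - e^{-a_j(-Δ)^α} f)`. -/
noncomputable def diffTransform {n : ℕ} (α : ℝ) (v a : ℤ → ℝ) (N : ℤ × ℤ)
    (f : EuclideanSpace ℝ (Fin n) → ℂ) (x : EuclideanSpace ℝ (Fin n)) : ℂ :=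
  ∑ j ∈ Finset.Icc N.1 N.2, (v j : ℂ) * (fracHeat α (a (j + 1)) f x - fracHeat α (a j) f x)

/-- The maximal operator `T^* f (x) = sup_N |T_N f (x)|`, the supremum being over all
`N = (N₁, N₂) ∈ ℤ²` with `N₁ < N₂`; it takes values in `[0, ∞]`. -/
noncomputable def maxDiffTransform {n : ℕ} (α : ℝ) (v a : ℤ → ℝ)
    (f : EuclideanSpace ℝ (Fin n) → ℂ) (x : EuclideanSpace ℝ (Fin n)) : ℝ≥0∞ :=
  ⨆ N : {N : ℤ × ℤ // N.1 < N.2}, ‖diffTransform α v a N f x‖ₑ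

/-! The fractional semigroup is an average of heat semigroups, so the estimate is proved for the
heat semigroup, uniformly over all increasing time sequences, and then averaged. No stable density
is used. The function `1 - (1 - x)^α` generates the Sibuya law, and `m^(-1/α)` times a sum of `m`
independent copies has Laplace transform `sibuyaLaplace`, which tends to `exp (-lam^α)`. Expanded in
powers of `exp (-lam * m^(-1/α))` at `lam = t^(1/α) |2πξ|²`, it exhibits an approximation of the
fractional operator as a nonnegative mixture, of mass at most one, of heat operators at times `i
m^(-1/α) t^(1/α)`. For fixed `i` and `m` these times increase with `t`, so each term is a heat
differential transform along another increasing sequence, and Fatou's lemma passes to the limit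
(`exists_maxDiffTransform_le_liminf`, `setLIntegral_maxDiffTransform_le`).

For the heat semigroup, cut `f` at the ball `B(z, 2r)`. Far from `x`, the kernel at `y` rises and
then falls in time, so its variation along any increasing sequence is at most twice its peak, a
multiple of `|y|^(-d)`. Integrating over `r ≤ |y| < 2` produces `log (2/r)`. Each single difference
is also at most twice the sup norm of `f`; Hölder's inequality against `v` combines the two bounds
into the power `1/p'` (`maxHeatDiffTransform_le_of_far`).

The part of `f` near the ball needs cancellation, but only `|v j| ≤ ‖v‖`. Parseval bounds the full
sum `g` in `L²`, a Cotlar inequality compares every tail of the sum with `heat (a k) g` up to a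
bounded error, and the maximal function over `heat (a k) g` has weak type `(2, 2)` by
Hardy–Littlewood. Kolmogorov's inequality turns this into a bounded mean over the ball
(`setLIntegral_window_le`). Since `log (2/r) ≥ 1`, the logarithmic term absorbs it. -/

/-! ### Sibuya generating functions and their stable limit. -/

/-- `G` agrees on `[0, 1)` with a power series with nonnegative coefficients of total mass at most
one and without constant term. -/
def IsSubPGF (G : ℝ → ℝ) : Prop :=
  ∃ w : ℕ → ℝ, (∀ i, 0 ≤ w i) ∧ w 0 = 0 ∧ Summable w ∧ ∑' i, w i ≤ 1 ∧
    ∀ x ∈ Set.Ico (0 : ℝ) 1, HasSum (fun i => w i * x ^ i) (G x)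

/-- Cauchy product: the generating function of a sum of independent variables. Vanishing constant
terms are carried along so that time `0` never receives mass. -/
theorem IsSubPGF.mul {G H : ℝ → ℝ} (hG : IsSubPGF G) (hH : IsSubPGF H) :
    IsSubPGF (fun x => G x * H x) := by
  obtain ⟨u, hu0, hu00, hus, hu1, hu⟩ := hG
  obtain ⟨v, hv0, hv00, hvs, hv1, hv⟩ := hH
  have hun : Summable fun i => ‖u i‖ := by simpa only [Real.norm_of_nonneg (hu0 _)] using hus
  have hvn : Summable fun i => ‖v i‖ := by simpa only [Real.norm_of_nonneg (hv0 _)] using hvs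
  refine ⟨fun m => ∑ k ∈ Finset.HasAntidiagonal.antidiagonal m, u k.1 * v k.2,
    fun i => Finset.sum_nonneg fun k _ => mul_nonneg (hu0 _) (hv0 _), by simp [hu00], ?_, ?_, ?_⟩
  · exact (summable_norm_sum_mul_antidiagonal_of_summable_norm hun hvn).of_norm
  · rw [← tsum_mul_tsum_eq_tsum_sum_antidiagonal_of_summable_norm hun hvn]
    exact mul_le_one₀ hu1 (tsum_nonneg hv0) hv1
  · intro x hx
    have hux := (hu x hx).summable.norm
    have hvx := (hv x hx).summable.norm
    have key := tsum_mul_tsum_eq_tsum_sum_antidiagonal_of_summable_norm hux hvx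
    have hs := (summable_norm_sum_mul_antidiagonal_of_summable_norm hux hvx).of_norm
    rw [(hu x hx).tsum_eq, (hv x hx).tsum_eq] at key
    have := hs.hasSum
    rw [← key] at this
    refine (funext fun m => ?_ : (fun m => _) = _) ▸ this
    rw [Finset.sum_mul]
    refine Eq.symm <| Finset.sum_congr rfl fun k hk => ?_
    rw [← Finset.HasAntidiagonal.mem_antidiagonal.1 hk, pow_add]
    ring

theorem IsSubPGF.pow {G : ℝ → ℝ} (hG : IsSubPGF G) {m : ℕ} (hm : 1 ≤ m) :
    IsSubPGF (fun x => G x ^ m) := by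
  induction m, hm using Nat.le_induction with
  | base => simpa using hG
  | succ k _ ih => simpa only [pow_succ] using ih.mul hG

theorem Ring.choose_succ_mul_real (a : ℝ) (i : ℕ) :
    Ring.choose a (i + 1) * (i + 1) = Ring.choose a i * (a - i) := by
  rw [Ring.choose_eq_smul, Ring.choose_eq_smul, descPochhammer_succ_right, Polynomial.smeval_mul,
    Nat.factorial_succ]
  have h1 : ((i : ℝ) + 1) ≠ 0 := by positivity
  have h2 : ((i.factorial : ℕ) : ℝ) ≠ 0 := by positivity
  simp [Polynomial.smeval_natCast]
  field_simp

/-- The probability generating function `1 - (1 - x)^α` of the Sibuya distribution. -/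
theorem isSubPGF_one_sub_rpow {α : ℝ} (hα0 : 0 < α) (hα1 : α < 1) :
    IsSubPGF (fun x => 1 - (1 - x) ^ α) := by
  set w : ℕ → ℝ := fun i => if i = 0 then 0 else -((-1) ^ i * Ring.choose α i) with hw
  have hw0 : ∀ i, 0 ≤ w (i + 1) := by
    intro i
    induction i with
    | zero => simp [hw, hα0.le]
    | succ k ih =>
      -- The ratio of consecutive coefficients is `(k + 1 - α) / (k + 2)`, nonnegative because `α <
      -- 1`; this propagates the sign from `w 1 = α`.
      have hrec : w (k + 1 + 1) * (k + 1 + 1) = w (k + 1) * (k + 1 - α) := by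
        have := Ring.choose_succ_mul_real α (k + 1)
        simp only [hw, Nat.add_eq_zero_iff, one_ne_zero, and_false, if_false]
        push_cast at this
        rw [pow_succ _ (k + 1)]
        linear_combination ((-1) ^ (k + 1) : ℝ) * this
      have h1 : (0 : ℝ) < k + 1 + 1 := by positivity
      have h2 : (0 : ℝ) ≤ k + 1 - α := by
        have : (0 : ℝ) ≤ k := by positivity
        linarith
      have := mul_nonneg ih h2
      rw [← hrec] at this
      exact nonneg_of_mul_nonneg_left this h1
  have hw' : ∀ i, 0 ≤ w i := by
    intro i
    cases i with
    | zero => simp [hw]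
    | succ k => exact hw0 k
  have hsum : ∀ x ∈ Set.Ico (0 : ℝ) 1, HasSum (fun i => w i * x ^ i) (1 - (1 - x) ^ α) := by
    intro x hx
    have hb : -x ∈ Metric.eball (0 : ℝ) 1 := by
      simp only [Metric.mem_eball, edist_zero_right]
      rw [enorm_neg, Real.enorm_eq_ofReal hx.1]
      simpa using hx.2
    have h := (Real.one_add_rpow_hasFPowerSeriesOnBall_zero (a := α)).hasSum hb
    simp only [binomialSeries_apply, zero_add, List.ofFn_const, List.prod_replicate,
      smul_eq_mul] at h
    have h2 : HasSum (fun i : ℕ => if i = 0 then (1 : ℝ) else 0) 1 := by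
      convert hasSum_ite_eq (0 : ℕ) (1 : ℝ) using 1
    have h3 := h2.sub h
    rw [← sub_eq_add_neg] at h3
    refine (funext fun i => ?_ : (fun i => _) = _) ▸ h3
    by_cases hi : i = 0
    · simp [hi, hw]
    · simp only [hw, hi, if_false, neg_pow x]
      ring
  -- The total mass is obtained from finite partial sums by letting `x` increase to `1`, so no
  -- convergence at the endpoint is presupposed.
  have hpart : ∀ s : Finset ℕ, ∑ i ∈ s, w i ≤ 1 := by
    intro s
    have hlim : Filter.Tendsto (fun x : ℝ => ∑ i ∈ s, w i * x ^ i) (nhdsWithin 1 (Set.Iio 1))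
        (nhds (∑ i ∈ s, w i * 1 ^ i)) := by
      refine Filter.Tendsto.mono_left ?_ nhdsWithin_le_nhds
      exact (by fun_prop : Continuous fun x : ℝ => ∑ i ∈ s, w i * x ^ i).tendsto 1
    simp only [one_pow, mul_one] at hlim
    refine le_of_tendsto hlim ?_
    filter_upwards [Ioo_mem_nhdsLT (show (0 : ℝ) < 1 by norm_num)] with x hx
    calc ∑ i ∈ s, w i * x ^ i ≤ 1 - (1 - x) ^ α :=
          sum_le_hasSum s (fun i _ => mul_nonneg (hw' i) (pow_nonneg hx.1.le _))
            (hsum x ⟨hx.1.le, hx.2⟩)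
      _ ≤ 1 := by
          have : 0 ≤ (1 - x) ^ α := Real.rpow_nonneg (by linarith [hx.2]) _
          linarith
  have hs : Summable w := summable_of_sum_le hw' hpart
  exact ⟨w, hw', by simp [hw], hs, hs.tsum_le_of_sum_le hpart, hsum⟩

/-- The Laplace transform of a normalized sum of `m` Sibuya variables. -/
noncomputable def sibuyaLaplace (α : ℝ) (m : ℕ) (lam : ℝ) : ℝ :=
  (1 - (1 - Real.exp (-(lam * (m : ℝ) ^ (-α⁻¹)))) ^ α) ^ m

theorem sibuyaLaplace_nonneg {α : ℝ} (hα0 : 0 < α) (m : ℕ) {lam : ℝ} (hl : 0 ≤ lam) :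
    0 ≤ sibuyaLaplace α m lam := by
  have hδ : 0 ≤ lam * (m : ℝ) ^ (-α⁻¹) := mul_nonneg hl (Real.rpow_nonneg (by positivity) _)
  have h1 : Real.exp (-(lam * (m : ℝ) ^ (-α⁻¹))) ≤ 1 := Real.exp_le_one_iff.2 (by linarith)
  have h2 := Real.exp_pos (-(lam * (m : ℝ) ^ (-α⁻¹)))
  refine pow_nonneg (sub_nonneg.2 ?_) _
  exact Real.rpow_le_one (by linarith) (by linarith) hα0.le

/-- A bound independent of `m`, which serves as the dominating function on the Fourier side. With `u
= lam * m^(-1/α)` one has `m * u^α = lam^α`, and the two regimes `u ≤ 1` and `u ≥ 1` are treated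
separately. -/
theorem sibuyaLaplace_le {α : ℝ} (hα0 : 0 < α) (hα1 : α < 1) {m : ℕ} (hm : 1 ≤ m) {lam : ℝ}
    (hl : 0 ≤ lam) : sibuyaLaplace α m lam ≤ Real.exp (-(lam / 2) ^ α) := by
  have hm0 : (0 : ℝ) < m := by exact_mod_cast hm
  set δ : ℝ := (m : ℝ) ^ (-α⁻¹) with hδ
  have hδ0 : 0 < δ := Real.rpow_pos_of_pos hm0 _
  have hδα : δ ^ α = (m : ℝ)⁻¹ := by
    rw [hδ, ← Real.rpow_mul hm0.le, neg_mul, inv_mul_cancel₀ hα0.ne', Real.rpow_neg_one]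
  set u := lam * δ with hu
  have hu0 : 0 ≤ u := mul_nonneg hl hδ0.le
  have he1 : Real.exp (-u) ≤ 1 := Real.exp_le_one_iff.2 (by linarith)
  have he0 := Real.exp_pos (-u)
  have hb0 : 0 ≤ 1 - (1 - Real.exp (-u)) ^ α :=
    sub_nonneg.2 (Real.rpow_le_one (by linarith) (by linarith) hα0.le)
  have hmu : m * u ^ α = lam ^ α := by
    rw [hu, Real.mul_rpow hl hδ0.le, hδα]; field_simp
  change (1 - (1 - Real.exp (-u)) ^ α) ^ m ≤ _
  rcases le_total u 1 with h | h
  · have hexp : u / 2 ≤ 1 - Real.exp (-u) := by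
      have h3 : Real.exp (-u) ≤ (1 + u)⁻¹ := by
        rw [Real.exp_neg]
        exact inv_anti₀ (by linarith) (by linarith [Real.add_one_le_exp u])
      have h4 : (1 + u)⁻¹ ≤ 1 - u / 2 := by
        rw [inv_le_iff_one_le_mul₀ (by linarith)]
        nlinarith
      linarith
    calc (1 - (1 - Real.exp (-u)) ^ α) ^ m
        ≤ Real.exp (-(1 - Real.exp (-u)) ^ α) ^ m := by
          refine pow_le_pow_left₀ hb0 ?_ _
          exact Real.one_sub_le_exp_neg _
      _ = Real.exp (-(m * (1 - Real.exp (-u)) ^ α)) := by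
          rw [← Real.exp_nat_mul]; ring_nf
      _ ≤ Real.exp (-(lam / 2) ^ α) := by
          refine Real.exp_le_exp.2 (neg_le_neg ?_)
          have h5 : (u / 2) ^ α ≤ (1 - Real.exp (-u)) ^ α :=
            Real.rpow_le_rpow (by linarith) hexp hα0.le
          calc (lam / 2) ^ α = m * (u / 2) ^ α := by
                rw [Real.div_rpow hl (by norm_num), Real.div_rpow hu0 (by norm_num), ← hmu]; ring
            _ ≤ _ := by gcongr
  -- For `u ≥ 1` the base is at most `exp (-u)`, and `m * u ≥ m * u^α = lam^α`.
  · have h6 : 1 - Real.exp (-u) ≤ (1 - Real.exp (-u)) ^ α := by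
      have := Real.rpow_le_rpow_of_exponent_ge' (x := 1 - Real.exp (-u)) (by linarith)
        (by linarith) hα0.le hα1.le
      simpa using this
    calc (1 - (1 - Real.exp (-u)) ^ α) ^ m ≤ Real.exp (-u) ^ m :=
          pow_le_pow_left₀ hb0 (by linarith) _
      _ = Real.exp (-(m * u)) := by rw [← Real.exp_nat_mul]; ring_nf
      _ ≤ Real.exp (-(lam / 2) ^ α) := by
          refine Real.exp_le_exp.2 (neg_le_neg ?_)
          have h7 : u ^ α ≤ u := by
            simpa using Real.rpow_le_rpow_of_exponent_le h hα1.le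
          calc (lam / 2) ^ α ≤ lam ^ α :=
                Real.rpow_le_rpow (by linarith) (by linarith) hα0.le
            _ = m * u ^ α := hmu.symm
            _ ≤ m * u := by gcongr

/-- The base is `1 - c/m` with `c → lam^α`, because `1 - exp (-lam δ) ~ lam δ` and `δ^α = 1/m`. -/
theorem tendsto_sibuyaLaplace {α : ℝ} (hα0 : 0 < α) {lam : ℝ} (hl : 0 ≤ lam) :
    Filter.Tendsto (fun m : ℕ => sibuyaLaplace α m lam) Filter.atTop
      (nhds (Real.exp (-lam ^ α))) := by
  have hδ : Filter.Tendsto (fun m : ℕ => (m : ℝ) ^ (-α⁻¹)) Filter.atTop (nhds 0) :=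
    (tendsto_rpow_neg_atTop (inv_pos.2 hα0)).comp tendsto_natCast_atTop_atTop
  have hd : Filter.Tendsto (fun x : ℝ => x⁻¹ * (1 - Real.exp (-(lam * x))))
      (nhdsWithin 0 (Set.Ioi 0)) (nhds lam) := by
    have h1 : HasDerivAt (fun x : ℝ => 1 - Real.exp (-(lam * x))) lam 0 := by
      have h2 : HasDerivAt (fun x : ℝ => -(lam * x)) (-lam) 0 := by
        simpa using ((hasDerivAt_id (0 : ℝ)).const_mul lam).fun_neg
      have h3 := h2.exp.const_sub 1
      simpa using h3
    have h4 := h1.tendsto_slope_zero_right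
    simpa using h4
  have hδ' : Filter.Tendsto (fun m : ℕ => (m : ℝ) ^ (-α⁻¹)) Filter.atTop
      (nhdsWithin 0 (Set.Ioi 0)) := by
    refine tendsto_nhdsWithin_iff.2 ⟨hδ, ?_⟩
    filter_upwards [Filter.eventually_ge_atTop 1] with m hm
    exact Real.rpow_pos_of_pos (by exact_mod_cast hm) _
  have h5 := ((hd.comp hδ').rpow_const (Or.inr hα0.le) (p := α)).neg
  have h6 : Filter.Tendsto
      (fun m : ℕ => (m : ℝ) * (-(1 - Real.exp (-(lam * (m : ℝ) ^ (-α⁻¹)))) ^ α)) Filter.atTop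
      (nhds (-lam ^ α)) := by
    refine h5.congr' ?_
    filter_upwards [Filter.eventually_ge_atTop 1] with m hm
    have hm0 : (0 : ℝ) < m := by exact_mod_cast hm
    have hp : 0 < (m : ℝ) ^ (-α⁻¹) := Real.rpow_pos_of_pos hm0 _
    have hn : 0 ≤ 1 - Real.exp (-(lam * (m : ℝ) ^ (-α⁻¹))) :=
      sub_nonneg.2 (Real.exp_le_one_iff.2 (by have := mul_nonneg hl hp.le; linarith))
    simp only [Function.comp]
    rw [Real.mul_rpow (inv_nonneg.2 hp.le) hn, Real.inv_rpow hp.le, ← Real.rpow_mul hm0.le,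
      neg_mul, inv_mul_cancel₀ hα0.ne', Real.rpow_neg_one, inv_inv]
    ring
  have h7 := Real.tendsto_one_add_pow_exp_of_tendsto h6
  simpa only [sibuyaLaplace, sub_eq_add_neg] using h7

theorem exists_sibuyaLaplace_hasSum {α : ℝ} (hα0 : 0 < α) (hα1 : α < 1) {m : ℕ} (hm : 1 ≤ m) :
    ∃ w : ℕ → ℝ, (∀ i, 0 ≤ w i) ∧ w 0 = 0 ∧ Summable w ∧ ∑' i, w i ≤ 1 ∧
      ∀ lam : ℝ, 0 < lam →
        HasSum (fun i => w i * Real.exp (-(i * (m : ℝ) ^ (-α⁻¹) * lam)))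
          (sibuyaLaplace α m lam) := by
  obtain ⟨w, h0, h00, hs, h1, h⟩ := (isSubPGF_one_sub_rpow hα0 hα1).pow hm
  refine ⟨w, h0, h00, hs, h1, fun lam hl => ?_⟩
  have hp : 0 < (m : ℝ) ^ (-α⁻¹) := Real.rpow_pos_of_pos (by exact_mod_cast hm) _
  have := h (Real.exp (-(lam * (m : ℝ) ^ (-α⁻¹)))) ⟨(Real.exp_pos _).le, by
    rw [Real.exp_lt_one_iff]; have := mul_pos hl hp; linarith⟩
  refine (funext fun i => ?_ : (fun i => _) = _) ▸ this
  rw [← Real.exp_nat_mul]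
  ring_nf

/-! ### The heat kernel, its Fourier transform and its regularity in time. -/

section HeatKernel

variable {E : Type*} [NormedAddCommGroup E] [InnerProductSpace ℝ E]

/-- The Gaussian kernel `(4πt)^(-d/2) exp (-‖y‖²/(4t))` of the heat semigroup. -/
noncomputable def heatKernel (t : ℝ) (y : E) : ℝ :=
  (√(4 * Real.pi * t))⁻¹ ^ Module.finrank ℝ E * Real.exp (-‖y‖ ^ 2 / (4 * t))

theorem heatKernel_nonneg (t : ℝ) (y : E) : 0 ≤ heatKernel t y := by
  unfold heatKernel; positivity

theorem continuous_heatKernel (t : ℝ) : Continuous (heatKernel t : E → ℝ) := by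
  unfold heatKernel; fun_prop

theorem heatKernel_normalization {t : ℝ} (ht : 0 < t) (d : ℕ) :
    (√(4 * Real.pi * t)) ^ d = (4 * Real.pi * t) ^ (d / 2 : ℝ) := by
  rw [Real.sqrt_eq_rpow, ← Real.rpow_natCast, ← Real.rpow_mul (by positivity)]
  ring_nf

/-- The exponential factor grows with time, so only the normalization can shrink. -/
theorem heatKernel_ge {s t : ℝ} (hs : 0 < s) (hst : s ≤ t) (y : E) :
    (√(s / t)) ^ Module.finrank ℝ E * heatKernel s y ≤ heatKernel t y := by
  have ht := hs.trans_le hst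
  unfold heatKernel
  rw [← mul_assoc, ← mul_pow]
  have h1 : √(s / t) * (√(4 * Real.pi * s))⁻¹ = (√(4 * Real.pi * t))⁻¹ := by
    rw [← Real.sqrt_inv, ← Real.sqrt_inv, ← Real.sqrt_mul (by positivity)]
    congr 1
    field_simp
  rw [h1]
  gcongr 2
  rw [neg_div, neg_div]
  gcongr

variable [FiniteDimensional ℝ E] [MeasurableSpace E] [BorelSpace E]

/-- The heat semigroup `e^{tΔ} f`, as convolution with the heat kernel. -/
noncomputable def heat (t : ℝ) (f : E → ℂ) (x : E) : ℂ :=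
  ∫ y, f y * (heatKernel t (x - y) : ℂ)

theorem integrable_heatKernel {t : ℝ} (ht : 0 < t) :
    Integrable (heatKernel t : E → ℝ) := by
  have h := (GaussianFourier.integrable_cexp_neg_mul_sq_norm_add (V := E)
    (b := ((1 / (4 * t) : ℝ) : ℂ)) (by rw [Complex.ofReal_re]; positivity) 0 0).re
  simp only [zero_mul, add_zero] at h
  refine (h.const_mul ((√(4 * Real.pi * t))⁻¹ ^ Module.finrank ℝ E)).congr
    (Filter.Eventually.of_forall fun y => ?_)
  unfold heatKernel
  simp only
  congr 1
  have : (-((1 / (4 * t) : ℝ) : ℂ) * (‖y‖ : ℂ) ^ 2) = ((-‖y‖ ^ 2 / (4 * t) : ℝ) : ℂ) := by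
    push_cast; ring
  simp only [this, ← Complex.ofReal_exp]
  exact Complex.ofReal_re _

theorem integrable_ofReal_heatKernel {t : ℝ} (ht : 0 < t) :
    Integrable (fun y : E => (heatKernel t y : ℂ)) :=
  (integrable_heatKernel ht).ofReal

theorem integral_heatKernel {t : ℝ} (ht : 0 < t) : ∫ y : E, heatKernel t y = 1 := by
  unfold heatKernel
  rw [integral_const_mul]
  have h := GaussianFourier.integral_rexp_neg_mul_sq_norm (V := E) (b := 1 / (4 * t))
    (by positivity)
  have h2 : (fun y : E => Real.exp (-‖y‖ ^ 2 / (4 * t))) =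
      fun y : E => Real.exp (-(1 / (4 * t)) * ‖y‖ ^ 2) := by
    ext y; congr 1; ring
  rw [h2, h, inv_pow, heatKernel_normalization ht,
    show Real.pi / (1 / (4 * t)) = 4 * Real.pi * t by field_simp]
  exact inv_mul_cancel₀ (by positivity)

theorem integrable_heatKernel_sub {t : ℝ} (ht : 0 < t) (x : E) :
    Integrable (fun y : E => heatKernel t (x - y)) :=
  (integrable_heatKernel ht).comp_sub_left x

theorem integral_heatKernel_sub {t : ℝ} (ht : 0 < t) (x : E) :
    ∫ y : E, heatKernel t (x - y) = 1 := by
  rw [integral_sub_left_eq_self (fun y : E => heatKernel t y) volume x, integral_heatKernel ht]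

theorem fourier_heatKernel {t : ℝ} (ht : 0 < t) (ξ : E) :
    𝓕 (fun y : E => (heatKernel t y : ℂ)) ξ = (Real.exp (-t * (2 * Real.pi * ‖ξ‖) ^ 2) : ℂ) := by
  have hb : 0 < (((1 / (4 * t) : ℝ) : ℂ)).re := by rw [Complex.ofReal_re]; positivity
  have h := fourier_gaussian_innerProductSpace (V := E) hb ξ
  have h2 : (fun y : E => (heatKernel t y : ℂ)) =
      fun y : E => (((√(4 * Real.pi * t))⁻¹ ^ Module.finrank ℝ E : ℝ) : ℂ) •
        Complex.exp (-((1 / (4 * t) : ℝ) : ℂ) * (‖y‖ : ℂ) ^ 2) := by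
    ext y
    unfold heatKernel
    rw [Complex.ofReal_mul, smul_eq_mul, Complex.ofReal_exp]
    congr 2
    push_cast; ring
  have h3 : (Real.pi : ℂ) / ((1 / (4 * t) : ℝ) : ℂ) = ((4 * Real.pi * t : ℝ) : ℂ) := by
    push_cast; field_simp
  have h4 : ((4 * Real.pi * t : ℝ) : ℂ) ^ (Module.finrank ℝ E / 2 : ℂ) =
      (((√(4 * Real.pi * t)) ^ Module.finrank ℝ E : ℝ) : ℂ) := by
    rw [heatKernel_normalization ht, Complex.ofReal_cpow (by positivity)]
    push_cast; rfl
  have h5 : Complex.exp (-(Real.pi : ℂ) ^ 2 * (‖ξ‖ : ℂ) ^ 2 / ((1 / (4 * t) : ℝ) : ℂ)) =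
      (Real.exp (-t * (2 * Real.pi * ‖ξ‖) ^ 2) : ℂ) := by
    rw [Complex.ofReal_exp]; congr 1; push_cast; field_simp; ring
  rw [h2]
  rw [show (fun y : E => (((√(4 * Real.pi * t))⁻¹ ^ Module.finrank ℝ E : ℝ) : ℂ) •
        Complex.exp (-((1 / (4 * t) : ℝ) : ℂ) * (‖y‖ : ℂ) ^ 2)) =
        (((√(4 * Real.pi * t))⁻¹ ^ Module.finrank ℝ E : ℝ) : ℂ) • fun y : E =>
        Complex.exp (-((1 / (4 * t) : ℝ) : ℂ) * (‖y‖ : ℂ) ^ 2) from rfl,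
    show ∀ (c : ℂ) (φ : E → ℂ), 𝓕 (c • φ) = c • 𝓕 φ from fun c φ =>
      VectorFourier.fourierIntegral_const_smul _ _ _ φ c,
    Pi.smul_apply, h, h3, h4, h5, smul_eq_mul, ← mul_assoc, ← Complex.ofReal_mul, inv_pow,
    inv_mul_cancel₀ (by positivity), Complex.ofReal_one, one_mul]

theorem heat_eq_convolution (t : ℝ) (f : E → ℂ) :
    heat t f = MeasureTheory.convolution f (fun y : E => (heatKernel t y : ℂ))
      (ContinuousLinearMap.mul ℂ ℂ) volume := rfl

theorem integrable_heat {t : ℝ} (ht : 0 < t) {f : E → ℂ} (hf : Integrable f) :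
    Integrable (heat t f) := by
  rw [heat_eq_convolution]
  exact hf.integrable_convolution _ (integrable_ofReal_heatKernel ht)

theorem fourier_heat {t : ℝ} (ht : 0 < t) {f : E → ℂ} (hf : Integrable f) (ξ : E) :
    𝓕 (heat t f) ξ = (Real.exp (-t * (2 * Real.pi * ‖ξ‖) ^ 2) : ℂ) * 𝓕 f ξ := by
  rw [heat_eq_convolution, Real.fourier_mul_convolution_eq hf (integrable_ofReal_heatKernel ht),
    fourier_heatKernel ht, mul_comm]

theorem integrable_heatSymbol {t : ℝ} (ht : 0 < t) :
    Integrable (fun ξ : E => Real.exp (-t * (2 * Real.pi * ‖ξ‖) ^ 2)) := by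
  have h : (0 : ℝ) < 1 / (4 * (4 * Real.pi ^ 2 * t)) := by positivity
  have h2 := (integrable_heatKernel (E := E) (t := 1 / (4 * (4 * Real.pi ^ 2 * t))) h).const_mul
    ((√(4 * Real.pi * (1 / (4 * (4 * Real.pi ^ 2 * t))))) ^ Module.finrank ℝ E)
  refine h2.congr (Filter.Eventually.of_forall fun y => ?_)
  simp only [heatKernel]
  rw [← mul_assoc, inv_pow, mul_inv_cancel₀ (by positivity), one_mul]
  congr 1
  field_simp
  ring

theorem continuous_fourier_of_integrable {f : E → ℂ} (hf : Integrable f) : Continuous (𝓕 f) :=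
  VectorFourier.fourierIntegral_continuous Real.continuous_fourierChar
    (innerSL ℝ).continuous₂ hf

theorem norm_fourier_le_integral (f : E → ℂ) (ξ : E) : ‖𝓕 f ξ‖ ≤ ∫ x, ‖f x‖ := by
  rw [Real.fourier_eq]
  refine (norm_integral_le_integral_norm _).trans (le_of_eq ?_)
  simp_rw [Circle.norm_smul]

theorem integrable_heatSymbol_mul_fourier {t : ℝ} (ht : 0 < t) {f : E → ℂ} (hf : Integrable f) :
    Integrable (fun ξ : E => (Real.exp (-t * (2 * Real.pi * ‖ξ‖) ^ 2) : ℂ) * 𝓕 f ξ) :=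
  (integrable_heatSymbol ht).ofReal.mul_bdd (c := ∫ x, ‖f x‖)
    (continuous_fourier_of_integrable hf).aestronglyMeasurable
    (Filter.Eventually.of_forall (norm_fourier_le_integral f))

/-- The Fourier transform is moved from `f` onto a modulated Gaussian, whose transform is explicit;
hence integrability of `f` suffices and the identity holds at every point. -/
theorem fourierInv_heatSymbol_mul_fourier {t : ℝ} (ht : 0 < t) {f : E → ℂ} (hf : Integrable f) :
    𝓕⁻ (fun ξ : E => (Real.exp (-t * (2 * Real.pi * ‖ξ‖) ^ 2) : ℂ) * 𝓕 f ξ) = heat t f := by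
  ext x
  set g : E → ℂ := fun ξ => Complex.exp (-((4 * Real.pi ^ 2 * t : ℝ) : ℂ) * (‖ξ‖ : ℂ) ^ 2 +
    2 * Real.pi * Complex.I * (inner ℝ x ξ : ℝ)) with hg
  have hb : 0 < ((4 * Real.pi ^ 2 * t : ℝ) : ℂ).re := by rw [Complex.ofReal_re]; positivity
  have hgi : Integrable g := by
    have := GaussianFourier.integrable_cexp_neg_mul_sq_norm_add (V := E) hb
      (2 * Real.pi * Complex.I) x
    exact this
  have h1 : 𝓕⁻ (fun ξ : E => (Real.exp (-t * (2 * Real.pi * ‖ξ‖) ^ 2) : ℂ) * 𝓕 f ξ) x =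
      ∫ ξ, 𝓕 f ξ * g ξ := by
    rw [Real.fourierInv_eq']
    refine integral_congr_ae (Filter.Eventually.of_forall fun ξ => ?_)
    simp only [hg, smul_eq_mul]
    rw [mul_comm (Complex.ofReal _) (𝓕 f ξ), mul_left_comm, Complex.ofReal_exp, ← Complex.exp_add,
      real_inner_comm x ξ]
    congr 2
    push_cast
    ring
  have h2 : ∫ ξ, 𝓕 f ξ * g ξ = ∫ y, f y * 𝓕 g y := by
    simpa using! VectorFourier.integral_bilin_fourierIntegral_eq_flip (ContinuousLinearMap.mul ℂ ℂ)
      (L := innerₗ E) Real.continuous_fourierChar continuous_inner hf hgi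
  rw [h1, h2]
  unfold heat
  refine integral_congr_ae (Filter.Eventually.of_forall fun y => ?_)
  simp only
  congr 1
  rw [hg, fourier_gaussian_innerProductSpace' hb x y]
  unfold heatKernel
  rw [Complex.ofReal_mul (_ ^ _), Complex.ofReal_exp]
  congr 1
  · have h3 : (Real.pi : ℂ) / ((4 * Real.pi ^ 2 * t : ℝ) : ℂ) = ((4 * Real.pi * t : ℝ)⁻¹ : ℝ) := by
      have : (Real.pi : ℂ) ≠ 0 := by exact_mod_cast Real.pi_ne_zero
      push_cast; field_simp
    rw [h3, inv_pow, heatKernel_normalization ht, ← Real.inv_rpow (by positivity),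
      Complex.ofReal_cpow (by positivity)]
    push_cast; rfl
  · congr 1
    have : (Real.pi : ℂ) ≠ 0 := by exact_mod_cast Real.pi_ne_zero
    push_cast
    field_simp

theorem heat_heat {s t : ℝ} (hs : 0 < s) (ht : 0 < t) {f : E → ℂ} (hf : Integrable f) :
    heat s (heat t f) = heat (s + t) f := by
  rw [← fourierInv_heatSymbol_mul_fourier hs (integrable_heat ht hf),
    ← fourierInv_heatSymbol_mul_fourier (add_pos hs ht) hf]
  congr 1
  ext ξ
  rw [fourier_heat ht hf, ← mul_assoc, ← Complex.ofReal_mul, ← Real.exp_add]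
  congr 3
  ring

theorem integrable_mul_heatKernel {t : ℝ} (ht : 0 < t) {f : E → ℂ} (hf : AEStronglyMeasurable f)
    {A : ℝ} (hA : ∀ᵐ y, ‖f y‖ ≤ A) (x : E) :
    Integrable (fun y => f y * (heatKernel t (x - y) : ℂ)) :=
  (integrable_heatKernel_sub ht x).ofReal.bdd_mul (c := A) hf hA

theorem norm_heat_le {t : ℝ} (ht : 0 < t) {f : E → ℂ} {A : ℝ} (hA : ∀ᵐ y, ‖f y‖ ≤ A) (x : E) :
    ‖heat t f x‖ ≤ A := by
  have h : ‖heat t f x‖ ≤ ∫ y, A * heatKernel t (x - y) := by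
    refine norm_integral_le_of_norm_le ((integrable_heatKernel_sub ht x).const_mul A) ?_
    filter_upwards [hA] with y hy
    rw [norm_mul, Complex.norm_real, Real.norm_of_nonneg (heatKernel_nonneg _ _)]
    exact mul_le_mul_of_nonneg_right hy (heatKernel_nonneg _ _)
  rwa [integral_const_mul, integral_heatKernel_sub ht, mul_one] at h

/-- Lipschitz continuity of the heat semigroup in logarithmic time, in `L¹` norm. -/
theorem integral_abs_heatKernel_sub_le {s t : ℝ} (hs : 0 < s) (hst : s ≤ t) :
    ∫ y : E, |heatKernel t y - heatKernel s y| ≤ 2 * Module.finrank ℝ E * (1 - s / t) := by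
  have ht := hs.trans_le hst
  set d := Module.finrank ℝ E
  set q := √(s / t) ^ d with hq
  have hst1 : s / t ≤ 1 := (div_le_one ht).2 hst
  have hq1 : √(s / t) ≤ 1 := Real.sqrt_le_one.2 hst1
  have hq2 : s / t ≤ √(s / t) := Real.le_sqrt_of_sq_le (by
    have : 0 ≤ s / t := by positivity
    nlinarith)
  -- Bernoulli's inequality.
  have hqd : 1 - q ≤ d * (1 - s / t) := by
    have := one_add_mul_le_pow (a := √(s / t) - 1) (by linarith [Real.sqrt_nonneg (s / t)]) d
    rw [add_sub_cancel] at this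
    have h3 : (d : ℝ) * (1 - √(s / t)) ≤ d * (1 - s / t) := by gcongr
    linarith
  have hq1' : q ≤ 1 := pow_le_one₀ (Real.sqrt_nonneg _) hq1
  have hi := integrable_heatKernel (E := E) ht
  have hi' := integrable_heatKernel (E := E) hs
  -- Since `heatKernel t ≥ q * heatKernel s`, the negative part of the difference is at most `(1 -
  -- q) * heatKernel s`. The difference itself integrates to zero, so only twice this part remains.
  calc ∫ y : E, |heatKernel t y - heatKernel s y|
      ≤ ∫ y : E, (heatKernel t y - heatKernel s y) + 2 * ((1 - q) * heatKernel s y) := by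
        refine integral_mono (hi.sub hi').abs ((hi.sub hi').add ((hi'.const_mul _).const_mul _)) ?_
        intro y
        have h1 := heatKernel_ge hs hst y
        have h2 : 0 ≤ (1 - q) * heatKernel s y :=
          mul_nonneg (by linarith) (heatKernel_nonneg _ _)
        simp only
        rw [abs_le]
        constructor <;> linarith
    _ = 2 * (1 - q) := by
        rw [integral_add (f := fun y => heatKernel t y - heatKernel s y) (hi.sub hi') ((hi'.const_mul _).const_mul _), integral_sub hi hi',
          integral_const_mul, integral_const_mul, integral_heatKernel ht, integral_heatKernel hs]
        ring
    _ ≤ _ := by rw [mul_assoc]; gcongr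

theorem norm_heat_sub_heat_le {s t : ℝ} (hs : 0 < s) (hst : s ≤ t) {f : E → ℂ}
    (hf : AEStronglyMeasurable f) {A : ℝ} (hA : ∀ᵐ y, ‖f y‖ ≤ A) (x : E) :
    ‖heat t f x - heat s f x‖ ≤ A * (2 * Module.finrank ℝ E * (1 - s / t)) := by
  have ht := hs.trans_le hst
  have hA0 : 0 ≤ A := by
    obtain ⟨y, hy⟩ := hA.exists
    exact (norm_nonneg _).trans hy
  unfold heat
  rw [← integral_sub (integrable_mul_heatKernel ht hf hA x) (integrable_mul_heatKernel hs hf hA x)]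
  have hi := ((integrable_heatKernel (E := E) ht).sub (integrable_heatKernel hs)).abs
  have h : ‖∫ y, (f y * (heatKernel t (x - y) : ℂ) - f y * (heatKernel s (x - y) : ℂ))‖ ≤
      ∫ y, A * |heatKernel t (x - y) - heatKernel s (x - y)| := by
    refine norm_integral_le_of_norm_le ((hi.comp_sub_left x).const_mul A) ?_
    filter_upwards [hA] with y hy
    rw [← mul_sub, norm_mul, ← Complex.ofReal_sub, Complex.norm_real, Real.norm_eq_abs]
    gcongr
  refine h.trans ?_
  rw [integral_const_mul,
    integral_sub_left_eq_self (fun y : E => |heatKernel t y - heatKernel s y|) volume x]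
  gcongr
  exact integral_abs_heatKernel_sub_le hs hst

end HeatKernel

/-! ### Telescoping sums and variation of unimodal functions. -/

theorem Int.sum_Ico_sub {M : Type*} [AddCommGroup M] (F : ℤ → M) {a b : ℤ} (hab : a ≤ b) :
    ∑ j ∈ Finset.Ico a b, (F (j + 1) - F j) = F b - F a := by
  induction b, hab using Int.leInduction with
  | base => simp
  | succ b hb ih =>
    have h : Finset.Ico a (b + 1) = insert b (Finset.Ico a b) := by
      ext k; simp only [Finset.mem_Ico, Finset.mem_insert]; omega
    rw [h, Finset.sum_insert (by simp), ih]
    abel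

theorem Int.Icc_eq_Ico_add_one (a b : ℤ) : Finset.Icc a b = Finset.Ico a (b + 1) := by
  ext k; simp only [Finset.mem_Ico, Finset.mem_Icc]; omega

/-- The variation along a monotone sequence of a nonnegative function which increases on `(0, t₀]`
and decreases on `[t₀, ∞)` is at most twice its maximum. -/
theorem sum_abs_sub_le_of_unimodal {φ : ℝ → ℝ} {t₀ : ℝ} (hφ : ∀ t, 0 ≤ φ t)
    (hmono : ∀ s t, 0 < s → s ≤ t → t ≤ t₀ → φ s ≤ φ t)
    (hanti : ∀ s t, t₀ ≤ s → s ≤ t → φ t ≤ φ s) {a : ℤ → ℝ} (ha : ∀ j, 0 < a j)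
    (hmon : Monotone a) (N₁ N₂ : ℤ) :
    ∑ j ∈ Finset.Icc N₁ N₂, |φ (a (j + 1)) - φ (a j)| ≤ 2 * φ t₀ := by
  -- Reflecting the decreasing branch at height `φ t₀` gives a nondecreasing function with the same
  -- increments in absolute value on either branch, so its sums telescope.
  set ψ : ℝ → ℝ := fun t => if t ≤ t₀ then φ t else 2 * φ t₀ - φ t with hψ
  have hle : ∀ s t, 0 < s → s ≤ t → |φ t - φ s| ≤ ψ t - ψ s := by
    intro s t hs hst
    by_cases ht : t ≤ t₀
    · have h := hmono s t hs hst ht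
      simp only [hψ, ht, hst.trans ht, if_true]
      rw [abs_of_nonneg (by linarith)]
    · by_cases hs' : s ≤ t₀
      · have h1 := hmono s t₀ hs hs' le_rfl
        have h2 := hanti t₀ t le_rfl (not_le.1 ht).le
        simp only [hψ, ht, hs', if_true, if_false]
        rw [abs_le]; constructor <;> linarith
      · have h := hanti s t (not_le.1 hs').le hst
        simp only [hψ, ht, hs', if_false]
        rw [abs_le]; constructor <;> linarith
  have hψ0 : ∀ t, 0 < t → 0 ≤ ψ t ∧ ψ t ≤ 2 * φ t₀ := by
    intro t ht
    by_cases h : t ≤ t₀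
    · have := hmono t t₀ ht h le_rfl
      simp only [hψ, h, if_true]
      exact ⟨hφ t, by linarith [hφ t₀]⟩
    · have := hanti t₀ t le_rfl (not_le.1 h).le
      simp only [hψ, h, if_false]
      exact ⟨by linarith [hφ t₀], by linarith [hφ t]⟩
  rw [Int.Icc_eq_Ico_add_one]
  rcases le_total N₁ (N₂ + 1) with h | h
  · calc ∑ j ∈ Finset.Ico N₁ (N₂ + 1), |φ (a (j + 1)) - φ (a j)|
        ≤ ∑ j ∈ Finset.Ico N₁ (N₂ + 1), (ψ (a (j + 1)) - ψ (a j)) :=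
          Finset.sum_le_sum fun j _ => hle _ _ (ha j) (hmon (by omega))
      _ = ψ (a (N₂ + 1)) - ψ (a N₁) := Int.sum_Ico_sub (fun j => ψ (a j)) h
      _ ≤ 2 * φ t₀ := by linarith [(hψ0 _ (ha (N₂ + 1))).2, (hψ0 _ (ha N₁)).1]
  · rw [Finset.Ico_eq_empty (by omega), Finset.sum_empty]
    linarith [hφ t₀]

/-! ### Variation of the heat semigroup away from the diagonal. -/

section FarPart

variable {E : Type*} [NormedAddCommGroup E] [InnerProductSpace ℝ E]

/-- The normalizations have ratio `(t/s)^(d/2)`, and `1 + x ≤ exp x` at `x = t/s - 1` turns this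
into an exponential. No order between `s` and `t` is assumed, so both branches of the unimodality
are covered. -/
theorem heatKernel_le_of_le {s t : ℝ} (hs : 0 < s) (ht : 0 < t) (y : E)
    (h : Module.finrank ℝ E * ((t - s) / (2 * s)) ≤ ‖y‖ ^ 2 / (4 * s) - ‖y‖ ^ 2 / (4 * t)) :
    heatKernel s y ≤ heatKernel t y := by
  unfold heatKernel
  set d := Module.finrank ℝ E
  have h1 : (√(4 * Real.pi * s))⁻¹ = √(t / s) * (√(4 * Real.pi * t))⁻¹ := by
    rw [← Real.sqrt_inv, ← Real.sqrt_inv, ← Real.sqrt_mul (by positivity)]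
    congr 1
    field_simp
  have h2 : √(t / s) ≤ Real.exp ((t - s) / (2 * s)) := by
    rw [Real.sqrt_le_left (Real.exp_pos _).le, ← Real.exp_nat_mul]
    have := Real.add_one_le_exp (t / s - 1)
    have h3 : (2 : ℕ) * ((t - s) / (2 * s)) = t / s - 1 := by push_cast; field_simp
    rw [h3]; linarith
  rw [h1, mul_pow, mul_comm (√(t / s) ^ d), mul_assoc]
  gcongr
  calc √(t / s) ^ d * Real.exp (-‖y‖ ^ 2 / (4 * s))
      ≤ Real.exp ((t - s) / (2 * s)) ^ d * Real.exp (-‖y‖ ^ 2 / (4 * s)) := by gcongr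
    _ = Real.exp (d * ((t - s) / (2 * s)) + -‖y‖ ^ 2 / (4 * s)) := by
        rw [← Real.exp_nat_mul, Real.exp_add]
    _ ≤ _ := by
        refine Real.exp_le_exp.2 ?_
        rw [neg_div, neg_div]
        linarith

theorem sum_abs_heatKernel_sub_le (hd : 0 < Module.finrank ℝ E) {a : ℤ → ℝ} (ha : ∀ j, 0 < a j)
    (hmon : Monotone a) (N₁ N₂ : ℤ) {y : E} (hy : y ≠ 0) :
    ∑ j ∈ Finset.Icc N₁ N₂, |heatKernel (a (j + 1)) y - heatKernel (a j) y| ≤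
      2 * (√(Module.finrank ℝ E / (2 * Real.pi)) ^ Module.finrank ℝ E *
        (‖y‖⁻¹) ^ Module.finrank ℝ E) := by
  set d := Module.finrank ℝ E with hd'
  have hd0 : (0 : ℝ) < d := by exact_mod_cast hd
  have hY : 0 < ‖y‖ := norm_pos_iff.2 hy
  -- The critical point of the heat kernel in time at the point `y`.
  set t₀ : ℝ := ‖y‖ ^ 2 / (2 * d) with ht₀
  have ht₀0 : 0 < t₀ := by positivity
  have hYt : ‖y‖ ^ 2 = 2 * d * t₀ := by rw [ht₀]; field_simp
  -- The gap in the exponents equals the required bound times `t₀ / t`, so the comparison is decided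
  -- by the side of `t₀` on which the times lie.
  have key : ∀ s t : ℝ, 0 < s → 0 < t →
      ‖y‖ ^ 2 / (4 * s) - ‖y‖ ^ 2 / (4 * t) = d * ((t - s) / (2 * s)) * (t₀ / t) := by
    intro s t hs ht
    rw [hYt]; field_simp; ring
  refine (sum_abs_sub_le_of_unimodal (φ := fun t => heatKernel t y) (t₀ := t₀)
    (fun t => heatKernel_nonneg t y) ?_ ?_ ha hmon N₁ N₂).trans ?_
  · intro s t hs hst ht
    have ht' := hs.trans_le hst
    refine heatKernel_le_of_le hs ht' y ?_
    rw [key s t hs ht']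
    have h1 : 1 ≤ t₀ / t := (one_le_div ht').2 ht
    have h2 : 0 ≤ (d : ℝ) * ((t - s) / (2 * s)) :=
      mul_nonneg hd0.le (div_nonneg (by linarith) (by linarith))
    exact le_mul_of_one_le_right h2 h1
  · intro s t hs hst
    have hs' := ht₀0.trans_le hs
    have ht' := hs'.trans_le hst
    refine heatKernel_le_of_le ht' hs' y ?_
    rw [key t s ht' hs']
    have h1 : t₀ / s ≤ 1 := (div_le_one hs').2 hs
    have h2 : (d : ℝ) * ((s - t) / (2 * t)) ≤ 0 :=
      mul_nonpos_of_nonneg_of_nonpos hd0.le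
        (div_nonpos_of_nonpos_of_nonneg (by linarith) (by linarith))
    nlinarith
  · refine mul_le_mul_of_nonneg_left ?_ (by norm_num)
    simp only [heatKernel]
    have h1 : (√(4 * Real.pi * t₀))⁻¹ = √(d / (2 * Real.pi)) * ‖y‖⁻¹ := by
      have h2 : 4 * Real.pi * t₀ = (d / (2 * Real.pi))⁻¹ * ‖y‖ ^ 2 := by
        rw [ht₀]; field_simp; norm_num
      rw [h2, Real.sqrt_mul (by positivity), Real.sqrt_sq hY.le, Real.sqrt_inv, mul_inv, inv_inv]
    rw [h1, mul_pow]
    refine mul_le_of_le_one_right (by positivity) ?_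
    rw [Real.exp_le_one_iff]
    exact div_nonpos_of_nonpos_of_nonneg (by simp) (by positivity)

variable [FiniteDimensional ℝ E] [MeasurableSpace E] [BorelSpace E]

theorem integrableOn_inv_Ico {r R : ℝ} (hr : 0 < r) :
    IntegrableOn (fun y : ℝ => y⁻¹) (Set.Ico r R) := by
  have h : ContinuousOn (fun y : ℝ => y⁻¹) (Set.Icc r R) :=
    continuousOn_inv₀.mono fun y hy => (hr.trans_le hy.1).ne'
  exact h.integrableOn_Icc.mono_set Set.Ico_subset_Icc_self

theorem pow_smul_indicator_inv_pow {d : ℕ} (hd : 0 < d) {r R : ℝ} (hr : 0 < r) :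
    (fun y : ℝ => y ^ (d - 1) • (Set.Ico r R).indicator (fun ρ => (ρ⁻¹) ^ d) y) =
      (Set.Ico r R).indicator (fun y : ℝ => y⁻¹) := by
  ext y
  by_cases hy : y ∈ Set.Ico r R
  · have hy0 : y ≠ 0 := (hr.trans_le hy.1).ne'
    rw [Set.indicator_of_mem hy, Set.indicator_of_mem hy, smul_eq_mul]
    obtain ⟨k, rfl⟩ := Nat.exists_eq_add_of_lt hd
    rw [zero_add, Nat.add_sub_cancel, pow_succ, ← mul_assoc, ← mul_pow, mul_inv_cancel₀ hy0,
      one_pow, one_mul]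
  · rw [Set.indicator_of_notMem hy, Set.indicator_of_notMem hy, smul_zero]

theorem integrable_annulus_inv_norm_pow [Nontrivial E] {r R : ℝ} (hr : 0 < r) :
    Integrable (fun y : E =>
      (Set.Ico r R).indicator (fun ρ : ℝ => (ρ⁻¹) ^ Module.finrank ℝ E) ‖y‖) := by
  rw [integrable_fun_norm_addHaar volume
    (f := (Set.Ico r R).indicator (fun ρ : ℝ => (ρ⁻¹) ^ Module.finrank ℝ E)),
    pow_smul_indicator_inv_pow Module.finrank_pos hr]
  exact ((integrable_indicator_iff measurableSet_Ico).2 (integrableOn_inv_Ico hr)).integrableOn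

theorem integral_annulus_inv_norm_pow [Nontrivial E] {r R : ℝ} (hr : 0 < r) (hrR : r ≤ R) :
    ∫ y : E, (Set.Ico r R).indicator (fun ρ : ℝ => (ρ⁻¹) ^ Module.finrank ℝ E) ‖y‖ =
      Module.finrank ℝ E * (volume.real (Metric.ball (0 : E) 1) * Real.log (R / r)) := by
  rw [integral_fun_norm_addHaar volume
    ((Set.Ico r R).indicator (fun ρ : ℝ => (ρ⁻¹) ^ Module.finrank ℝ E)),
    pow_smul_indicator_inv_pow Module.finrank_pos hr,
    setIntegral_indicator measurableSet_Ico]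
  have h : Set.Ioi (0 : ℝ) ∩ Set.Ico r R = Set.Ico r R :=
    Set.inter_eq_right.2 fun y hy => hr.trans_le hy.1
  rw [h, integral_Ico_eq_integral_Ioc, ← intervalIntegral.integral_of_le hrR,
    integral_inv_of_pos hr (hr.trans_le hrR), nsmul_eq_mul, smul_eq_mul]

/-- The constant in the variation estimate for the heat semigroup away from the diagonal. -/
noncomputable def heatFarConst (d : ℕ) (V : ℝ) : ℝ :=
  2 * √(d / (2 * Real.pi)) ^ d * (d * V)

/-- Sum the kernel differences before integrating: the pointwise variation is a multiple of `‖x -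
y‖^(-d)`, whose integral over the annulus is logarithmic. -/
theorem sum_norm_heat_sub_le_of_far [Nontrivial E] {a : ℤ → ℝ} (ha : ∀ j, 0 < a j)
    (hmon : Monotone a) {f : E → ℂ} (hf : AEStronglyMeasurable f) {A : ℝ}
    (hA : ∀ᵐ y, ‖f y‖ ≤ A) {x : E} {r : ℝ} (hr : 0 < r) (hr2 : r ≤ 2)
    (hfx : ∀ᵐ y, ‖x - y‖ ∉ Set.Ico r 2 → f y = 0) (N₁ N₂ : ℤ) :
    ∑ j ∈ Finset.Icc N₁ N₂, ‖heat (a (j + 1)) f x - heat (a j) f x‖ ≤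
      A * (heatFarConst (Module.finrank ℝ E) (volume.real (Metric.ball (0 : E) 1)) *
        Real.log (2 / r)) := by
  set d := Module.finrank ℝ E with hd
  have hd0 : 0 < d := Module.finrank_pos
  have hdiff : ∀ j, ‖heat (a (j + 1)) f x - heat (a j) f x‖ ≤
      ∫ y, ‖f y‖ * |heatKernel (a (j + 1)) (x - y) - heatKernel (a j) (x - y)| := by
    intro j
    unfold heat
    rw [← integral_sub (integrable_mul_heatKernel (ha _) hf hA x)
      (integrable_mul_heatKernel (ha _) hf hA x)]
    refine (norm_integral_le_integral_norm _).trans (le_of_eq ?_)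
    refine integral_congr_ae (Filter.Eventually.of_forall fun y => ?_)
    simp only
    rw [← mul_sub, norm_mul, ← Complex.ofReal_sub, Complex.norm_real, Real.norm_eq_abs]
  have hint : ∀ j, Integrable fun y =>
      ‖f y‖ * |heatKernel (a (j + 1)) (x - y) - heatKernel (a j) (x - y)| := by
    intro j
    refine Integrable.bdd_mul (c := A) ?_ hf.norm ?_
    · exact ((integrable_heatKernel_sub (ha _) x).sub (integrable_heatKernel_sub (ha _) x)).abs
    · simpa using hA
  calc ∑ j ∈ Finset.Icc N₁ N₂, ‖heat (a (j + 1)) f x - heat (a j) f x‖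
      ≤ ∑ j ∈ Finset.Icc N₁ N₂,
        ∫ y, ‖f y‖ * |heatKernel (a (j + 1)) (x - y) - heatKernel (a j) (x - y)| :=
        Finset.sum_le_sum fun j _ => hdiff j
    _ = ∫ y, ∑ j ∈ Finset.Icc N₁ N₂,
        ‖f y‖ * |heatKernel (a (j + 1)) (x - y) - heatKernel (a j) (x - y)| :=
        (integral_finsetSum _ fun j _ => hint j).symm
    _ ≤ ∫ y, A * (2 * √(d / (2 * Real.pi)) ^ d) *
        (Set.Ico r 2).indicator (fun ρ : ℝ => (ρ⁻¹) ^ d) ‖x - y‖ := by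
        refine integral_mono_ae (integrable_finsetSum _ fun j _ => hint j) ?_ ?_
        · exact ((integrable_annulus_inv_norm_pow hr).comp_sub_left x).const_mul _
        · filter_upwards [hA, hfx] with y hy hfy
          rw [← Finset.mul_sum]
          by_cases hxy : ‖x - y‖ ∈ Set.Ico r 2
          · rw [Set.indicator_of_mem hxy]
            have h0 : x - y ≠ 0 := norm_pos_iff.1 (hr.trans_le hxy.1)
            calc _ ≤ A * (2 * (√(d / (2 * Real.pi)) ^ d * (‖x - y‖⁻¹) ^ d)) := by
                  gcongr
                  · exact (norm_nonneg _).trans hy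
                  · exact sum_abs_heatKernel_sub_le hd0 ha hmon N₁ N₂ h0
              _ = _ := by ring
          · rw [Set.indicator_of_notMem hxy, hfy hxy]
            simp
    _ = _ := by
        rw [integral_const_mul, integral_sub_left_eq_self (fun y : E =>
          (Set.Ico r 2).indicator (fun ρ : ℝ => (ρ⁻¹) ^ d) ‖y‖) volume x,
          integral_annulus_inv_norm_pow hr hr2, heatFarConst]
        ring

end FarPart

/-! ### Interpolation between the sup bound and the sum bound. -/

/-- Hölder's inequality against a bounded summable sequence. -/
theorem lp_sum_abs_mul_le {p q : ℝ≥0∞} (hp : 1 ≤ p) (hpq : ENNReal.HolderConjugate p q)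
    (v : lp (fun _ : ℤ => ℝ) p) {u : ℤ → ℝ} {A B : ℝ} (hA : 0 ≤ A) (hB : 0 ≤ B)
    (s : Finset ℤ) (hu0 : ∀ j, 0 ≤ u j) (hu1 : ∀ j, u j ≤ 2 * A)
    (hu : ∑ j ∈ s, u j ≤ A * B) :
    ∑ j ∈ s, |v j| * u j ≤ 2 * B ^ (1 / q).toReal * ‖v‖ * A := by
  have hp0 : p ≠ 0 := (zero_lt_one.trans_le hp).ne'
  have hv0 : 0 ≤ ‖v‖ := lp.norm_nonneg' v
  have hinv := hpq.inv_add_inv_eq_inv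
  rcases eq_or_ne p ∞ with rfl | hpt
  · have hq : (1 / q).toReal = 1 := by
      simp only [ENNReal.inv_top, zero_add, inv_one] at hinv
      rw [one_div, hinv, ENNReal.toReal_one]
    rw [hq, Real.rpow_one]
    calc ∑ j ∈ s, |v j| * u j ≤ ∑ j ∈ s, ‖v‖ * u j := by
          refine Finset.sum_le_sum fun j _ => mul_le_mul_of_nonneg_right ?_ (hu0 j)
          exact lp.norm_apply_le_norm hp0 v j
      _ = ‖v‖ * ∑ j ∈ s, u j := (Finset.mul_sum _ _ _).symm
      _ ≤ ‖v‖ * (A * B) := by gcongr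
      _ ≤ _ := by nlinarith [mul_nonneg hv0 (mul_nonneg hA hB)]
  rcases eq_or_ne q ∞ with rfl | hqt
  · have hp1 : p = 1 := by
      simp only [ENNReal.inv_top, add_zero, inv_one] at hinv
      exact ENNReal.inv_eq_one.1 hinv
    subst hp1
    have h1 := lp.sum_rpow_le_norm_rpow (by simp) v s
    simp only [ENNReal.toReal_one, Real.rpow_one] at h1
    simp only [one_div, ENNReal.inv_top, ENNReal.toReal_zero, Real.rpow_zero]
    calc ∑ j ∈ s, |v j| * u j ≤ ∑ j ∈ s, ‖v j‖ * (2 * A) := by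
          refine Finset.sum_le_sum fun j _ => mul_le_mul_of_nonneg_left (hu1 j) (abs_nonneg _)
      _ = (∑ j ∈ s, ‖v j‖) * (2 * A) := (Finset.sum_mul _ _ _).symm
      _ ≤ ‖v‖ * (2 * A) := by gcongr
      _ = _ := by ring
  · have hr := ENNReal.HolderConjugate.toReal_of_ne_top hpt hqt
    set P := p.toReal
    set Q := q.toReal
    have hq1 : (1 / q).toReal = 1 / Q := by rw [one_div, ENNReal.toReal_inv, one_div]
    have hQ0 : 0 < Q := hr.symm.pos
    have hQ1 : 1 ≤ Q := hr.symm.lt.le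
    -- Interpolation: `u^Q ≤ (2A)^(Q-1) * u`, and then the bound on the sum applies.
    have hQs : ∑ j ∈ s, u j ^ Q ≤ (2 * A) ^ Q * B := by
      calc ∑ j ∈ s, u j ^ Q ≤ ∑ j ∈ s, (2 * A) ^ (Q - 1) * u j := by
            refine Finset.sum_le_sum fun j _ => ?_
            rcases (hu0 j).eq_or_lt with h0 | h0
            · rw [← h0, Real.zero_rpow hQ0.ne', mul_zero]
            · calc u j ^ Q = u j ^ (Q - 1) * u j := by
                    rw [← Real.rpow_add_one h0.ne']; ring_nf
                _ ≤ _ := by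
                    refine mul_le_mul_of_nonneg_right ?_ (hu0 j)
                    exact Real.rpow_le_rpow (hu0 j) (hu1 j) (by linarith)
        _ = (2 * A) ^ (Q - 1) * ∑ j ∈ s, u j := (Finset.mul_sum _ _ _).symm
        _ ≤ (2 * A) ^ (Q - 1) * (A * B) := by gcongr
        _ ≤ (2 * A) ^ (Q - 1) * (2 * A * B) := by
            gcongr
            linarith
        _ = (2 * A) ^ Q * B := by
            rcases hA.eq_or_lt with h0 | h0
            · rw [← h0, mul_zero, Real.zero_rpow hQ0.ne']; ring
            · rw [← mul_assoc, ← Real.rpow_add_one (by positivity)]; ring_nf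
    rw [hq1]
    calc ∑ j ∈ s, |v j| * u j
        ≤ (∑ j ∈ s, |v j| ^ P) ^ (1 / P) * (∑ j ∈ s, u j ^ Q) ^ (1 / Q) :=
          Real.inner_le_Lp_mul_Lq_of_nonneg s hr (fun _ _ => abs_nonneg _) (fun j _ => hu0 j)
      _ ≤ (‖v‖ ^ P) ^ (1 / P) * ((2 * A) ^ Q * B) ^ (1 / Q) := by
          have h1 : ∑ j ∈ s, |v j| ^ P ≤ ‖v‖ ^ P := lp.sum_rpow_le_norm_rpow hr.pos v s
          have h2 : 0 ≤ ∑ j ∈ s, u j ^ Q := Finset.sum_nonneg fun j _ => Real.rpow_nonneg (hu0 j) _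
          gcongr
      _ = ‖v‖ * (2 * A * B ^ (1 / Q)) := by
          rw [Real.mul_rpow (by positivity) hB, ← Real.rpow_mul hv0, ← Real.rpow_mul (by positivity),
            mul_one_div_cancel hr.pos.ne', mul_one_div_cancel hQ0.ne', Real.rpow_one, Real.rpow_one]
      _ = _ := by ring

/-! ### Parseval's identity and the `L²` bound. -/

section Parseval

variable {E : Type*} [NormedAddCommGroup E] [InnerProductSpace ℝ E] [FiniteDimensional ℝ E]
  [MeasurableSpace E] [BorelSpace E]

theorem continuous_heat {t : ℝ} (ht : 0 < t) {f : E → ℂ} (hf : Integrable f) :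
    Continuous (heat t f) := by
  rw [← fourierInv_heatSymbol_mul_fourier ht hf, Real.fourierInv_eq_fourier_comp_neg]
  exact continuous_fourier_of_integrable (integrable_heatSymbol_mul_fourier ht hf).comp_neg

theorem fourier_sub_of_integrable {f g : E → ℂ} (hf : Integrable f) (hg : Integrable g) (ξ : E) :
    𝓕 (fun x => f x - g x) ξ = 𝓕 f ξ - 𝓕 g ξ := by
  simp only [Real.fourier_eq, smul_sub]
  exact integral_sub ((Real.fourierIntegral_convergent_iff ξ).2 hf)
    ((Real.fourierIntegral_convergent_iff ξ).2 hg)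

theorem fourier_finsetSum_mul {ι : Type*} (s : Finset ι) (c : ι → ℂ) {F : ι → E → ℂ}
    (hF : ∀ j, Integrable (F j)) (ξ : E) :
    𝓕 (fun x => ∑ j ∈ s, c j * F j x) ξ = ∑ j ∈ s, c j * 𝓕 (F j) ξ := by
  simp only [Real.fourier_eq, Finset.smul_sum, ← integral_const_mul]
  rw [integral_finsetSum _ fun j _ =>
    (Real.fourierIntegral_convergent_iff ξ).2 ((hF j).const_mul (c j))]
  refine Finset.sum_congr rfl fun j _ => integral_congr_ae (Filter.Eventually.of_forall fun x => ?_)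
  simp only [mul_smul_comm]

/-- Parseval's identity for continuous integrable functions with integrable Fourier transform. -/
theorem integral_norm_sq_fourier_eq {g : E → ℂ} (hc : Continuous g) (hg : Integrable g)
    (hg' : Integrable (𝓕 g)) : ∫ ξ, ‖𝓕 g ξ‖ ^ 2 = ∫ x, ‖g x‖ ^ 2 := by
  have h := VectorFourier.integral_sesq_fourierIntegral_eq_neg_flip (innerSL ℂ (E := ℂ))
    (L := innerₗ E) Real.continuous_fourierChar continuous_inner hg hg'
  have h2 : VectorFourier.fourierIntegral Real.fourierChar volume (-(innerₗ E).flip) (𝓕 g) = g := by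
    have : VectorFourier.fourierIntegral Real.fourierChar volume (-(innerₗ E).flip) (𝓕 g) =
        𝓕⁻ (𝓕 g) := by
      ext x
      rw [Real.fourierInv_eq]
      simp [VectorFourier.fourierIntegral, real_inner_comm]
    rw [this, hc.fourierInv_fourier_eq hg hg']
  rw [h2] at h
  change ∫ ξ, innerSL ℂ (𝓕 g ξ) (𝓕 g ξ) = ∫ x, innerSL ℂ (g x) (g x) at h
  simp only [innerSL_apply_apply, inner_self_eq_norm_sq_to_K] at h
  have h3 : ∀ φ : E → ℂ, ∫ x, ((‖φ x‖ : ℂ)) ^ 2 = ((∫ x, ‖φ x‖ ^ 2 : ℝ) : ℂ) := by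
    intro φ
    rw [← integral_complex_ofReal]
    push_cast
    rfl
  exact_mod_cast (h3 (𝓕 g)).symm.trans (h.trans (h3 g))

theorem integral_norm_heat_le {t : ℝ} (ht : 0 < t) {f : E → ℂ} (hf : Integrable f) :
    ∫ x, ‖heat t f x‖ ≤ ∫ x, ‖f x‖ := by
  have h1 : ∀ x, ‖heat t f x‖ ≤ MeasureTheory.convolution (fun y => ‖f y‖)
      (fun y : E => heatKernel t y) (ContinuousLinearMap.mul ℝ ℝ) volume x := by
    intro x
    refine (norm_integral_le_integral_norm _).trans (le_of_eq ?_)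
    refine integral_congr_ae (Filter.Eventually.of_forall fun y => ?_)
    simp [abs_of_nonneg (heatKernel_nonneg t (x - y))]
  refine (integral_mono (integrable_heat ht hf).norm
    (hf.norm.integrable_convolution _ (integrable_heatKernel ht)) h1).trans (le_of_eq ?_)
  rw [integral_convolution _ hf.norm (integrable_heatKernel ht), integral_heatKernel ht]
  simp

theorem integrable_norm_sq_of_bounded {g : E → ℂ} (hg : Integrable g) {A : ℝ}
    (hA : ∀ᵐ y, ‖g y‖ ≤ A) : Integrable (fun x => ‖g x‖ ^ 2) := by
  simp only [pow_two]
  exact hg.norm.bdd_mul (c := A) hg.aestronglyMeasurable.norm (by simpa using hA)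

/-- Interpolating the sup and `L¹` bounds avoids a Plancherel theorem for `f` itself, whose
transform need not be integrable. For `f` supported in a ball the bound still has the right size. -/
theorem integral_norm_sq_heat_le {t : ℝ} (ht : 0 < t) {f : E → ℂ} (hf : Integrable f) {A : ℝ}
    (hA : ∀ᵐ y, ‖f y‖ ≤ A) : ∫ x, ‖heat t f x‖ ^ 2 ≤ A * ∫ x, ‖f x‖ := by
  have hb := norm_heat_le ht hA
  have hA0 : 0 ≤ A := (norm_nonneg _).trans (hb 0)
  have hi := integrable_heat ht hf
  calc ∫ x, ‖heat t f x‖ ^ 2 ≤ ∫ x, A * ‖heat t f x‖ := by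
        refine integral_mono (integrable_norm_sq_of_bounded hi (Filter.Eventually.of_forall hb))
          (hi.norm.const_mul A) fun x => ?_
        simp only [pow_two]
        exact mul_le_mul_of_nonneg_right (hb x) (norm_nonneg _)
    _ = A * ∫ x, ‖heat t f x‖ := integral_const_mul _ _
    _ ≤ _ := mul_le_mul_of_nonneg_left (integral_norm_heat_le ht hf) hA0

/-- Differences of the heat semigroup along a monotone sequence of times, with bounded
coefficients, are bounded on `L²`. -/
theorem integral_norm_sq_sum_heat_sub_le {v a : ℤ → ℝ} {V : ℝ} (hv : ∀ j, |v j| ≤ V)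
    (ha : ∀ j, 0 < a j) (hmon : Monotone a) {f : E → ℂ} (hf : Integrable f) {A : ℝ}
    (hA : ∀ᵐ y, ‖f y‖ ≤ A) {k₁ k₂ : ℤ} (hk : k₁ ≤ k₂) :
    ∫ x, ‖∑ j ∈ Finset.Ico k₁ k₂, (v j : ℂ) * (heat (a (j + 1)) f x - heat (a j) f x)‖ ^ 2 ≤
      V ^ 2 * (A * ∫ x, ‖f x‖) := by
  have hV : 0 ≤ V := (abs_nonneg _).trans (hv 0)
  set F : ℤ → E → ℂ := fun j x => heat (a (j + 1)) f x - heat (a j) f x with hF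
  have hFi : ∀ j, Integrable (F j) := fun j =>
    (integrable_heat (ha _) hf).sub (integrable_heat (ha _) hf)
  have hFc : ∀ j, Continuous (F j) := fun j =>
    (continuous_heat (ha _) hf).sub (continuous_heat (ha _) hf)
  set g : E → ℂ := fun x => ∑ j ∈ Finset.Ico k₁ k₂, (v j : ℂ) * F j x with hg
  have hgi : Integrable g := integrable_finsetSum _ fun j _ => (hFi j).const_mul _
  have hgc : Continuous g := continuous_finsetSum _ fun j _ => continuous_const.mul (hFc j)
  set e : ℝ → E → ℝ := fun t ξ => Real.exp (-t * (2 * Real.pi * ‖ξ‖) ^ 2) with he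
  have hFF : ∀ j ξ, 𝓕 (F j) ξ = ((e (a (j + 1)) ξ - e (a j) ξ : ℝ) : ℂ) * 𝓕 f ξ := by
    intro j ξ
    rw [hF, fourier_sub_of_integrable (integrable_heat (ha _) hf) (integrable_heat (ha _) hf),
      fourier_heat (ha _) hf, fourier_heat (ha _) hf, ← sub_mul, Complex.ofReal_sub]
  have hgF : ∀ ξ, 𝓕 g ξ = ∑ j ∈ Finset.Ico k₁ k₂, (v j : ℂ) * 𝓕 (F j) ξ :=
    fourier_finsetSum_mul _ _ hFi
  -- The symbols decrease in time, so their absolute differences telescope to at most the first one.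
  -- Keeping that symbol, rather than bounding it by `1`, also makes `𝓕 g` integrable, as Parseval
  -- requires.
  have hbound : ∀ ξ, ‖𝓕 g ξ‖ ≤ V * ‖𝓕 (heat (a k₁) f) ξ‖ := by
    intro ξ
    have hanti : ∀ s t, s ≤ t → e t ξ ≤ e s ξ := fun s t hst =>
      Real.exp_le_exp.2 (mul_le_mul_of_nonneg_right (neg_le_neg hst) (sq_nonneg _))
    rw [hgF, fourier_heat (ha _) hf]
    calc ‖∑ j ∈ Finset.Ico k₁ k₂, (v j : ℂ) * 𝓕 (F j) ξ‖
        ≤ ∑ j ∈ Finset.Ico k₁ k₂, V * ((-e (a (j + 1)) ξ - -e (a j) ξ) * ‖𝓕 f ξ‖) := by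
          refine norm_sum_le_of_le _ fun j _ => ?_
          rw [hFF, norm_mul, norm_mul, Complex.norm_real, Complex.norm_real, Real.norm_eq_abs,
            Real.norm_eq_abs, abs_of_nonpos (sub_nonpos.2 (hanti _ _ (hmon (by omega))))]
          refine mul_le_mul (hv j) (le_of_eq (by ring)) (mul_nonneg ?_ (norm_nonneg _)) hV
          linarith [hanti _ _ (hmon (show j ≤ j + 1 by omega))]
      _ = V * ((-e (a k₂) ξ - -e (a k₁) ξ) * ‖𝓕 f ξ‖) := by
          rw [← Finset.mul_sum, ← Finset.sum_mul, Int.sum_Ico_sub (fun j => -e (a j) ξ) hk]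
      _ ≤ V * (e (a k₁) ξ * ‖𝓕 f ξ‖) := by
          gcongr
          linarith [Real.exp_pos (-a k₂ * (2 * Real.pi * ‖ξ‖) ^ 2)]
      _ = _ := by
          rw [norm_mul, Complex.norm_real, Real.norm_of_nonneg (Real.exp_pos _).le]
  have hPi : Integrable (𝓕 (heat (a k₁) f)) :=
    (integrable_heatSymbol_mul_fourier (ha k₁) hf).congr
      (Filter.Eventually.of_forall fun ξ => (fourier_heat (ha _) hf ξ).symm)
  have hPb := norm_fourier_le_integral (heat (a k₁) f)
  have hgFi : Integrable (𝓕 g) :=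
    (hPi.norm.const_mul V).mono' (continuous_fourier_of_integrable hgi).aestronglyMeasurable
      (Filter.Eventually.of_forall hbound)
  have hsq := integrable_norm_sq_of_bounded hPi (Filter.Eventually.of_forall hPb)
  calc ∫ x, ‖g x‖ ^ 2 = ∫ ξ, ‖𝓕 g ξ‖ ^ 2 := (integral_norm_sq_fourier_eq hgc hgi hgFi).symm
    _ ≤ ∫ ξ, V ^ 2 * ‖𝓕 (heat (a k₁) f) ξ‖ ^ 2 := by
        refine integral_mono_of_nonneg (Filter.Eventually.of_forall fun ξ => sq_nonneg _)
          (hsq.const_mul _) (Filter.Eventually.of_forall fun ξ => ?_)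
        simp only
        rw [← mul_pow]
        exact pow_le_pow_left₀ (norm_nonneg _) (hbound ξ) 2
    _ = V ^ 2 * ∫ x, ‖heat (a k₁) f x‖ ^ 2 := by
        rw [integral_const_mul, integral_norm_sq_fourier_eq (continuous_heat (ha _) hf)
          (integrable_heat (ha _) hf) hPi]
    _ ≤ _ := by gcongr; exact integral_norm_sq_heat_le (ha _) hf hA

end Parseval

/-! ### Maximal functions, weak type bounds and Kolmogorov's inequality. -/

section MaximalFunction

variable {E : Type*} [NormedAddCommGroup E] [InnerProductSpace ℝ E] [FiniteDimensional ℝ E]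
  [MeasurableSpace E] [BorelSpace E]

theorem lintegral_exp_neg_Ioi (q : ℝ) :
    ∫⁻ u in Set.Ioi q, ENNReal.ofReal (Real.exp (-u)) = ENNReal.ofReal (Real.exp (-q)) := by
  rw [← integral_exp_neg_Ioi q, ofReal_integral_eq_lintegral_ofReal (integrableOn_exp_neg_Ioi q)]
  exact Filter.Eventually.of_forall fun u => (Real.exp_pos _).le

/-- The Gaussian is a superposition of indicators of balls. -/
theorem lintegral_mul_heatKernel_eq {t : ℝ} (ht : 0 < t) {φ : E → ℝ≥0∞} (hφ : AEMeasurable φ)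
    (x : E) :
    ∫⁻ y, φ y * ENNReal.ofReal (heatKernel t (x - y)) =
      ENNReal.ofReal ((√(4 * Real.pi * t))⁻¹ ^ Module.finrank ℝ E) *
        ∫⁻ u in Set.Ioi (0 : ℝ), ENNReal.ofReal (Real.exp (-u)) *
          ∫⁻ y in Metric.ball x √(4 * t * u), φ y := by
  set c := ENNReal.ofReal ((√(4 * Real.pi * t))⁻¹ ^ Module.finrank ℝ E)
  have hmem : ∀ y u, 0 < u → (y ∈ Metric.ball x √(4 * t * u) ↔ ‖x - y‖ ^ 2 / (4 * t) < u) := by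
    intro y u hu
    rw [Metric.mem_ball, dist_comm, dist_eq_norm, Real.lt_sqrt (norm_nonneg _),
      div_lt_iff₀ (by positivity), mul_comm u]
  -- Layer cake: `exp (-q)` is the integral of `exp (-u)` over `u > q`, and `q < u` says that `y`
  -- lies in a ball about `x`.
  have h1 : ∀ y, φ y * ENNReal.ofReal (heatKernel t (x - y)) =
      ∫⁻ u in Set.Ioi (0 : ℝ), c * (φ y * {p : E × ℝ | ‖x - p.1‖ ^ 2 / (4 * t) < p.2}.indicator
        (fun p => ENNReal.ofReal (Real.exp (-p.2))) (y, u)) := by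
    intro y
    have hq : 0 ≤ ‖x - y‖ ^ 2 / (4 * t) := by positivity
    have hind : ∀ u, {p : E × ℝ | ‖x - p.1‖ ^ 2 / (4 * t) < p.2}.indicator
        (fun p => ENNReal.ofReal (Real.exp (-p.2))) (y, u) =
        (Set.Ioi (‖x - y‖ ^ 2 / (4 * t))).indicator
          (fun u => ENNReal.ofReal (Real.exp (-u))) u := fun u => rfl
    simp only [hind]
    have hm : Measurable fun u => (Set.Ioi (‖x - y‖ ^ 2 / (4 * t))).indicator
          (fun u => ENNReal.ofReal (Real.exp (-u))) u :=
      (by fun_prop : Measurable fun u : ℝ => ENNReal.ofReal (Real.exp (-u))).indicator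
        measurableSet_Ioi
    rw [lintegral_const_mul _ (hm.const_mul _), lintegral_const_mul _ hm,
      setLIntegral_indicator measurableSet_Ioi,
      Set.inter_eq_left.2 (Set.Ioi_subset_Ioi hq), lintegral_exp_neg_Ioi]
    unfold heatKernel
    rw [ENNReal.ofReal_mul (by positivity), neg_div]
    ring
  have hmeas : MeasurableSet {p : E × ℝ | ‖x - p.1‖ ^ 2 / (4 * t) < p.2} :=
    measurableSet_lt (by fun_prop) (by fun_prop)
  have hjoint : AEMeasurable (Function.uncurry fun (y : E) (u : ℝ) => c * (φ y *
      {p : E × ℝ | ‖x - p.1‖ ^ 2 / (4 * t) < p.2}.indicator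
        (fun p => ENNReal.ofReal (Real.exp (-p.2))) (y, u)))
      (volume.prod (volume.restrict (Set.Ioi (0 : ℝ)))) := by
    refine (AEMeasurable.mul (hφ.comp_fst) ?_).const_mul c
    exact (Measurable.indicator (by fun_prop) hmeas).aemeasurable
  rw [lintegral_congr h1, lintegral_lintegral_swap hjoint]
  rw [← lintegral_const_mul' _ _ ENNReal.ofReal_ne_top]
  refine setLIntegral_congr_fun measurableSet_Ioi fun u hu => ?_
  rw [lintegral_const_mul' c _ ENNReal.ofReal_ne_top, ← lintegral_indicator measurableSet_ball,
    ← lintegral_const_mul' (ENNReal.ofReal (Real.exp (-u))) _ ENNReal.ofReal_ne_top]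
  congr 1
  refine lintegral_congr fun y => ?_
  by_cases hy : y ∈ Metric.ball x √(4 * t * u)
  · rw [Set.indicator_of_mem hy, Set.indicator_of_mem (show (y, u) ∈ _ from (hmem y u hu).1 hy),
      mul_comm]
  · rw [Set.indicator_of_notMem hy,
      Set.indicator_of_notMem (show (y, u) ∉ {p : E × ℝ | ‖x - p.1‖ ^ 2 / (4 * t) < p.2} from
        fun h => hy ((hmem y u hu).2 h)), mul_zero, mul_zero]

theorem lintegral_heatKernel_sub {t : ℝ} (ht : 0 < t) (x : E) :
    ∫⁻ y : E, ENNReal.ofReal (heatKernel t (x - y)) = 1 := by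
  rw [← ofReal_integral_eq_lintegral_ofReal (integrable_heatKernel_sub ht x)
    (Filter.Eventually.of_forall fun y => heatKernel_nonneg _ _), integral_heatKernel_sub ht,
    ENNReal.ofReal_one]

/-- The constant `K` has the same superposition over balls, because the kernel has mass one; the two
are compared ball by ball. -/
theorem lintegral_mul_heatKernel_le {t : ℝ} (ht : 0 < t) {φ : E → ℝ≥0∞} (hφ : AEMeasurable φ)
    {x : E} {K : ℝ≥0∞} (hK : ∀ ρ > 0, ∫⁻ y in Metric.ball x ρ, φ y ≤ K * volume (Metric.ball x ρ)) :
    ∫⁻ y, φ y * ENNReal.ofReal (heatKernel t (x - y)) ≤ K := by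
  have h1 : ∫⁻ y : E, K * ENNReal.ofReal (heatKernel t (x - y)) = K := by
    rw [lintegral_const_mul _ (by
      have := continuous_heatKernel (E := E) t
      fun_prop), lintegral_heatKernel_sub ht, mul_one]
  conv_rhs => rw [← h1]
  rw [lintegral_mul_heatKernel_eq ht hφ, lintegral_mul_heatKernel_eq ht aemeasurable_const]
  gcongr _ * ?_
  refine setLIntegral_mono' measurableSet_Ioi fun u hu => ?_
  gcongr _ * ?_
  rw [setLIntegral_const]
  have hu' : (0 : ℝ) < u := hu
  exact hK _ (Real.sqrt_pos.2 (by positivity))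

/-- If all averages of `‖g‖²` over balls centered at `x` are at most `K²`, then the heat semigroup
applied to `g` is at most `K` at `x`. -/
theorem enorm_heat_le_of_average_le {t : ℝ} (ht : 0 < t) {g : E → ℂ} (hg : AEStronglyMeasurable g)
    {x : E} {K : ℝ} (hK0 : 0 < K)
    (hK : ∀ ρ > 0, ∫⁻ y in Metric.ball x ρ, ‖g y‖ₑ ^ 2 ≤
      ENNReal.ofReal K ^ 2 * volume (Metric.ball x ρ)) :
    ‖heat t g x‖ₑ ≤ ENNReal.ofReal K := by
  set k := ENNReal.ofReal K with hk
  have hk0 : k ≠ 0 := by simpa [hk] using hK0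
  have hkt : k ≠ ∞ := ENNReal.ofReal_ne_top
  have hm : Measurable fun y : E => ENNReal.ofReal (heatKernel t (x - y)) := by
    have := continuous_heatKernel (E := E) t
    fun_prop
  have h1 : ‖heat t g x‖ₑ ≤ ∫⁻ y, ‖g y‖ₑ * ENNReal.ofReal (heatKernel t (x - y)) := by
    refine (enorm_integral_le_lintegral_enorm _).trans (le_of_eq (lintegral_congr fun y => ?_))
    rw [enorm_mul, ← ofReal_norm (Complex.ofReal _), Complex.norm_real,
      Real.norm_of_nonneg (heatKernel_nonneg _ _)]
  have h2 := lintegral_mul_heatKernel_le ht (φ := fun y => ‖g y‖ₑ ^ 2) (hg.enorm.pow_const 2) hK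
  -- `2k|g| ≤ |g|² + k²` integrated against the kernel replaces Cauchy–Schwarz.
  have h3 : 2 * k * ∫⁻ y, ‖g y‖ₑ * ENNReal.ofReal (heatKernel t (x - y)) ≤ 2 * k * k := by
    calc 2 * k * ∫⁻ y, ‖g y‖ₑ * ENNReal.ofReal (heatKernel t (x - y))
        = ∫⁻ y, 2 * k * (‖g y‖ₑ * ENNReal.ofReal (heatKernel t (x - y))) :=
          (lintegral_const_mul' _ _ (ENNReal.mul_ne_top (by norm_num) hkt)).symm
      _ ≤ ∫⁻ y, (‖g y‖ₑ ^ 2 * ENNReal.ofReal (heatKernel t (x - y)) +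
          k ^ 2 * ENNReal.ofReal (heatKernel t (x - y))) := by
          refine lintegral_mono fun y => ?_
          simp only
          rw [← add_mul, ← mul_assoc]
          gcongr
          rw [← ofReal_norm, hk, ← ENNReal.ofReal_pow (norm_nonneg _),
            ← ENNReal.ofReal_pow hK0.le, ← ENNReal.ofReal_add (by positivity) (by positivity),
            show (2 : ℝ≥0∞) = ENNReal.ofReal 2 by simp, ← ENNReal.ofReal_mul (by norm_num),
            ← ENNReal.ofReal_mul (by positivity)]
          exact ENNReal.ofReal_le_ofReal (by nlinarith [sq_nonneg (‖g y‖ - K)])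
      _ ≤ k ^ 2 + k ^ 2 * 1 := by
          rw [lintegral_add_right _ (hm.const_mul _), lintegral_const_mul _ hm,
            lintegral_heatKernel_sub ht]
          gcongr
      _ = 2 * k * k := by ring
  exact h1.trans ((ENNReal.mul_le_mul_iff_right (by simp [hk0])
    (ENNReal.mul_ne_top (by norm_num) hkt)).1 h3)

/-- The weak type `(1, 1)` inequality for the centered Hardy–Littlewood maximal function. -/
theorem measure_exists_average_gt_le [Nontrivial E] (φ : E → ℝ≥0∞) {K : ℝ≥0∞}
    (hK0 : K ≠ 0) (hKt : K ≠ ∞) (hφ : ∫⁻ y, φ y ≠ ∞) :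
    volume {x : E | ∃ ρ > 0, K * volume (Metric.ball x ρ) < ∫⁻ y in Metric.ball x ρ, φ y} ≤
      4 ^ Module.finrank ℝ E * (K⁻¹ * ∫⁻ y, φ y) := by
  set S := {x : E | ∃ ρ > 0, K * volume (Metric.ball x ρ) < ∫⁻ y in Metric.ball x ρ, φ y} with hS
  set d := Module.finrank ℝ E
  have hd : d ≠ 0 := Module.finrank_pos.ne'
  choose! ρ hρ0 hρ using fun x (hx : x ∈ S) => hx
  have hlt : ∀ x ∈ S, volume (Metric.ball x (ρ x)) ≤
      K⁻¹ * ∫⁻ y in Metric.ball x (ρ x), φ y := fun x hx => by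
    rw [← ENNReal.div_eq_inv_mul, ENNReal.le_div_iff_mul_le (Or.inl hK0) (Or.inl hKt), mul_comm]
    exact (hρ x hx).le
  set J := (K⁻¹ * ∫⁻ y, φ y) / volume (Metric.ball (0 : E) 1) with hJ
  have hB0 : volume (Metric.ball (0 : E) 1) ≠ 0 := (Metric.measure_ball_pos _ _ one_pos).ne'
  have hBt : volume (Metric.ball (0 : E) 1) ≠ ∞ := measure_ball_lt_top.ne
  have hJt : J ≠ ∞ := ENNReal.div_ne_top (ENNReal.mul_ne_top (by simpa using hK0) hφ) hB0
  -- The Vitali selection needs bounded radii; the finite mass of `φ` bounds `ρ^d`, hence `ρ` once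
  -- `ρ ≥ 1`.
  have hR : ∀ x ∈ S, ρ x ≤ max 1 J.toReal := by
    intro x hx
    rcases le_total (ρ x) 1 with h | h
    · exact h.trans (le_max_left _ _)
    · refine le_trans ?_ (le_max_right _ _)
      have h1 : ENNReal.ofReal (ρ x ^ d) * volume (Metric.ball (0 : E) 1) ≤
          K⁻¹ * ∫⁻ y, φ y := by
        rw [← Measure.addHaar_ball volume x (hρ0 x hx).le]
        exact (hlt x hx).trans 
          (mul_le_mul_right (setLIntegral_le_lintegral _ _) _)
      have h2 : ENNReal.ofReal (ρ x ^ d) ≤ J :=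
        (ENNReal.le_div_iff_mul_le (Or.inl hB0) (Or.inl hBt)).2 h1
      exact (le_self_pow₀ h hd).trans ((ENNReal.ofReal_le_iff_le_toReal hJt).1 h2)
  obtain ⟨u, huS, hdisj, hcov⟩ := Vitali.exists_disjoint_subfamily_covering_enlargement_ball S id ρ
    (max 1 J.toReal) hR 4 (by norm_num)
  simp only [id] at hdisj hcov
  have hcount : u.Countable := hdisj.countable_of_isOpen (fun _ _ => Metric.isOpen_ball)
    fun x hx => ⟨x, Metric.mem_ball_self (hρ0 x (huS hx))⟩
  calc volume S ≤ volume (⋃ b ∈ u, Metric.ball b (4 * ρ b)) := by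
        refine measure_mono fun x hx => ?_
        obtain ⟨b, hb, hsub⟩ := hcov x hx
        exact Set.mem_biUnion hb (hsub (Metric.mem_ball_self (hρ0 x hx)))
    _ ≤ ∑' b : u, volume (Metric.ball (b : E) (4 * ρ b)) := measure_biUnion_le _ hcount _
    _ ≤ ∑' b : u, 4 ^ d * (K⁻¹ * ∫⁻ y in Metric.ball (b : E) (ρ b), φ y) := by
        refine ENNReal.tsum_le_tsum fun b => ?_
        have hb := huS b.2
        rw [Measure.addHaar_ball_mul volume _ (by norm_num : (0 : ℝ) ≤ 4),
          ENNReal.ofReal_pow (by norm_num), show ENNReal.ofReal 4 = 4 by simp,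
          ← Measure.addHaar_ball_center volume (b : E)]
        gcongr
        exact hlt b hb
    _ = 4 ^ d * (K⁻¹ * ∫⁻ y in ⋃ b ∈ u, Metric.ball b (ρ b), φ y) := by
        rw [ENNReal.tsum_mul_left, ENNReal.tsum_mul_left,
          lintegral_biUnion hcount (fun _ _ => measurableSet_ball) hdisj]
    _ ≤ _ := by
        gcongr
        exact Measure.restrict_le_self

/-- Kolmogorov's inequality: a weak `L²` bound controls integrals over sets of finite measure. -/
theorem setLIntegral_le_of_weakL2 {X : Type*} [MeasurableSpace X] {μ : Measure X} {U : X → ℝ}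
    (hU : Measurable U) (hU0 : ∀ x, 0 ≤ U x) {K : ℝ≥0∞}
    (hK : ∀ t : ℝ, 0 < t → μ {x | t < U x} ≤ K * ENNReal.ofReal (t ^ 2)⁻¹) (B : Set X) {τ : ℝ}
    (hτ : 0 < τ) :
    ∫⁻ x in B, ENNReal.ofReal (U x) ∂μ ≤ μ B * ENNReal.ofReal τ + K * ENNReal.ofReal τ⁻¹ := by
  rw [lintegral_eq_lintegral_meas_lt _ (Filter.Eventually.of_forall hU0) hU.aemeasurable,
    ← Set.Ioc_union_Ioi_eq_Ioi hτ.le]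
  refine (lintegral_union_le _ _ _).trans (add_le_add ?_ ?_)
  · calc ∫⁻ t in Set.Ioc 0 τ, (μ.restrict B) {x | t < U x}
        ≤ ∫⁻ _ in Set.Ioc 0 τ, μ B := by
          refine lintegral_mono fun t => ?_
          exact (measure_mono (Set.subset_univ _)).trans_eq (Measure.restrict_apply_univ B)
      _ = μ B * ENNReal.ofReal τ := by
          rw [setLIntegral_const, Real.volume_Ioc, sub_zero]
  · calc ∫⁻ t in Set.Ioi τ, (μ.restrict B) {x | t < U x}
        ≤ ∫⁻ t in Set.Ioi τ, K * ENNReal.ofReal (t ^ 2)⁻¹ := by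
          refine setLIntegral_mono' measurableSet_Ioi fun t ht => ?_
          exact (Measure.restrict_le_self _).trans (hK t (hτ.trans ht))
      _ = K * ∫⁻ t in Set.Ioi τ, ENNReal.ofReal (t ^ 2)⁻¹ :=
          lintegral_const_mul _ (by fun_prop)
      _ = K * ENNReal.ofReal τ⁻¹ := by
          congr 1
          have hi := integrableOn_Ioi_rpow_of_lt (a := -2) (by norm_num) hτ
          have h1 := integral_Ioi_rpow_of_lt (a := -2) (by norm_num) hτ
          have h2 : ∀ t ∈ Set.Ioi τ, ENNReal.ofReal (t ^ 2)⁻¹ = ENNReal.ofReal (t ^ (-2 : ℝ)) := by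
            intro t ht
            have ht0 : (0 : ℝ) < t := hτ.trans ht
            rw [Real.rpow_neg ht0.le]
            norm_num
          rw [setLIntegral_congr_fun measurableSet_Ioi h2,
            ← ofReal_integral_eq_lintegral_ofReal hi, h1]
          · congr 1
            norm_num
            rw [Real.rpow_neg_one]
          · filter_upwards [ae_restrict_mem measurableSet_Ioi] with t ht
            exact Real.rpow_nonneg (hτ.trans ht).le _

end MaximalFunction

/-! ### A Cotlar inequality for tails. -/

section Cotlar

variable {E : Type*} [NormedAddCommGroup E] [InnerProductSpace ℝ E] [FiniteDimensional ℝ E]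
  [MeasurableSpace E] [BorelSpace E]

theorem heat_sub {t : ℝ} (ht : 0 < t) {f g : E → ℂ} {A B : ℝ} (hf : AEStronglyMeasurable f)
    (hA : ∀ᵐ y, ‖f y‖ ≤ A) (hg : AEStronglyMeasurable g) (hB : ∀ᵐ y, ‖g y‖ ≤ B) (x : E) :
    heat t (fun y => f y - g y) x = heat t f x - heat t g x := by
  unfold heat
  rw [← integral_sub (integrable_mul_heatKernel ht hf hA x) (integrable_mul_heatKernel ht hg hB x)]
  simp only [sub_mul]

theorem heat_finsetSum_mul {ι : Type*} {t : ℝ} (ht : 0 < t) (s : Finset ι) (c : ι → ℂ)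
    {F : ι → E → ℂ} {A : ℝ} (hF : ∀ j, AEStronglyMeasurable (F j)) (hA : ∀ j, ∀ᵐ y, ‖F j y‖ ≤ A)
    (x : E) : heat t (fun y => ∑ j ∈ s, c j * F j y) x = ∑ j ∈ s, c j * heat t (F j) x := by
  unfold heat
  simp only [← integral_const_mul, Finset.sum_mul]
  rw [integral_finsetSum]
  · simp only [mul_assoc]
  · intro j _
    simp only [mul_assoc]
    exact (integrable_mul_heatKernel ht (hF j) (hA j) x).const_mul _

/-- Second order regularity of the heat semigroup in time. -/
theorem norm_heat_second_difference_le {a b s : ℝ} (ha : 0 < a) (hab : a ≤ b) (hs : 0 < s)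
    {f : E → ℂ} (hf : Integrable f) {A : ℝ} (hA : ∀ᵐ y, ‖f y‖ ≤ A) (x : E) :
    ‖(heat b f x - heat a f x) - (heat (b + s) f x - heat (a + s) f x)‖ ≤
      A * (16 * (Module.finrank ℝ E : ℝ) ^ 2 * (s * (1 / a - 1 / b))) := by
  set d : ℝ := ((Module.finrank ℝ E : ℕ) : ℝ) with hd
  have hb := ha.trans_le hab
  have hA0 : 0 ≤ A := (norm_nonneg _).trans (norm_heat_le ha hA 0)
  -- The time `a / 2` is split off by the semigroup law: the second difference is a first
  -- difference, between times `a / 2` and `b - a / 2`, of `φ`, itself a first difference. The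
  -- logarithmic Lipschitz bound is then used twice.
  set φ : E → ℂ := fun y => heat (a / 2) f y - heat (a / 2 + s) f y with hφ
  have h1 : 0 < a / 2 := by positivity
  have h2 : 0 < a / 2 + s := by positivity
  have h3 : 0 < b - a / 2 := by linarith
  have hφb : ∀ y, ‖φ y‖ ≤ A * (4 * d * (s / a)) := by
    intro y
    rw [hφ, norm_sub_rev]
    refine (norm_heat_sub_heat_le h1 (by linarith) hf.aestronglyMeasurable hA y).trans ?_
    refine mul_le_mul_of_nonneg_left ?_ hA0
    have h4 : 1 - a / 2 / (a / 2 + s) ≤ 2 * (s / a) := by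
      rw [one_sub_div h2.ne', div_le_iff₀ h2]
      have : 2 * (s / a) * (a / 2 + s) = s + 2 * s ^ 2 / a := by field_simp
      rw [this]
      have : 0 ≤ 2 * s ^ 2 / a := by positivity
      linarith
    calc 2 * d * (1 - a / 2 / (a / 2 + s)) ≤ 2 * d * (2 * (s / a)) := by gcongr
      _ = _ := by ring
  have hφi : Integrable φ := (integrable_heat h1 hf).sub (integrable_heat h2 hf)
  have hcomp : ∀ t, 0 < t → heat t φ x = heat (t + a / 2) f x - heat (t + a / 2 + s) f x := by
    intro t ht
    rw [hφ, heat_sub ht (integrable_heat h1 hf).aestronglyMeasurable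
      (Filter.Eventually.of_forall (norm_heat_le h1 hA))
      (integrable_heat h2 hf).aestronglyMeasurable
      (Filter.Eventually.of_forall (norm_heat_le h2 hA)), heat_heat ht h1 hf, heat_heat ht h2 hf,
      ← add_assoc]
  have h5 := hcomp (b - a / 2) h3
  have h6 := hcomp (a / 2) h1
  rw [sub_add_cancel] at h5
  rw [add_halves] at h6
  have h7 : (heat b f x - heat a f x) - (heat (b + s) f x - heat (a + s) f x) =
      heat (b - a / 2) φ x - heat (a / 2) φ x := by rw [h5, h6]; ring
  rw [h7]
  refine (norm_heat_sub_heat_le h1 (by linarith) hφi.aestronglyMeasurable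
    (Filter.Eventually.of_forall hφb) x).trans ?_
  have h8 : 1 - a / 2 / (b - a / 2) ≤ 2 * ((b - a) / b) := by
    rw [one_sub_div h3.ne', ← mul_div_assoc, div_le_div_iff₀ h3 hb]
    nlinarith
  calc A * (4 * d * (s / a)) * (2 * d * (1 - a / 2 / (b - a / 2)))
      ≤ A * (4 * d * (s / a)) * (2 * d * (2 * ((b - a) / b))) := by gcongr
    _ = _ := by field_simp; ring

/-- The tails of the heat differential transform differ from averages of the full transform by a
bounded function (a Cotlar type inequality). -/
theorem norm_tail_sub_heat_le {v a : ℤ → ℝ} {V : ℝ} (hv : ∀ j, |v j| ≤ V)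
    (ha : ∀ j, 0 < a j) (hmon : Monotone a) {f : E → ℂ} (hf : Integrable f) {A : ℝ}
    (hA : ∀ᵐ y, ‖f y‖ ≤ A) {k₁ k k₂ : ℤ} (hk₁ : k₁ ≤ k) (hk₂ : k ≤ k₂) (x : E) :
    ‖∑ j ∈ Finset.Ico k k₂, (v j : ℂ) * (heat (a (j + 1)) f x - heat (a j) f x) -
      heat (a k) (fun y => ∑ j ∈ Finset.Ico k₁ k₂,
        (v j : ℂ) * (heat (a (j + 1)) f y - heat (a j) f y)) x‖ ≤
      V * A * (2 * Module.finrank ℝ E + 16 * (Module.finrank ℝ E : ℝ) ^ 2) := by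
  set d : ℝ := ((Module.finrank ℝ E : ℕ) : ℝ) with hd
  have hd0 : 0 ≤ d := Nat.cast_nonneg _
  have hV : 0 ≤ V := (abs_nonneg _).trans (hv 0)
  have hA0 : 0 ≤ A := (norm_nonneg _).trans (norm_heat_le (ha 0) hA 0)
  set s := a k with hs
  have hs0 : 0 < s := ha k
  have hmeas : ∀ t, 0 < t → AEStronglyMeasurable (heat t f) := fun t ht =>
    (integrable_heat ht hf).aestronglyMeasurable
  have hbd : ∀ t, 0 < t → ∀ᵐ y, ‖heat t f y‖ ≤ A := fun t ht =>
    Filter.Eventually.of_forall (norm_heat_le ht hA)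
  have hcomp : heat s (fun y => ∑ j ∈ Finset.Ico k₁ k₂,
      (v j : ℂ) * (heat (a (j + 1)) f y - heat (a j) f y)) x =
      ∑ j ∈ Finset.Ico k₁ k₂, (v j : ℂ) * (heat (a (j + 1) + s) f x - heat (a j + s) f x) := by
    rw [heat_finsetSum_mul (A := A + A) hs0 _ (fun j => (v j : ℂ))
      (F := fun j y => heat (a (j + 1)) f y - heat (a j) f y)
      (fun j => (hmeas _ (ha _)).sub (hmeas _ (ha _)))
      (fun j => Filter.Eventually.of_forall fun y => (norm_sub_le _ _).trans
        (add_le_add (norm_heat_le (ha _) hA y) (norm_heat_le (ha _) hA y)))]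
    refine Finset.sum_congr rfl fun j _ => ?_
    rw [heat_sub hs0 (hmeas _ (ha _)) (hbd _ (ha _)) (hmeas _ (ha _)) (hbd _ (ha _)),
      heat_heat hs0 (ha _) hf, heat_heat hs0 (ha _) hf, add_comm s, add_comm s]
  have hsplit : ∀ G : ℤ → ℂ, ∑ j ∈ Finset.Ico k₁ k₂, G j =
      ∑ j ∈ Finset.Ico k₁ k, G j + ∑ j ∈ Finset.Ico k k₂, G j := by
    intro G
    rw [← Finset.Ico_union_Ico_eq_Ico hk₁ hk₂,
      Finset.sum_union (Finset.Ico_disjoint_Ico_consecutive _ _ _)]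
  -- Before `k`, the added time `s = a k` makes each increment at most a multiple of `(a (j+1) - a
  -- j) / s`; these sum to at most one.
  have hI : ‖∑ j ∈ Finset.Ico k₁ k, (v j : ℂ) * (heat (a (j + 1) + s) f x - heat (a j + s) f x)‖ ≤
      V * A * (2 * d) := by
    calc ‖∑ j ∈ Finset.Ico k₁ k, (v j : ℂ) * (heat (a (j + 1) + s) f x - heat (a j + s) f x)‖
        ≤ ∑ j ∈ Finset.Ico k₁ k, V * (A * (2 * d * ((a (j + 1) - a j) / s))) := by
          refine norm_sum_le_of_le _ fun j hj => ?_
          rw [norm_mul, Complex.norm_real, Real.norm_eq_abs]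
          have hjj : a j ≤ a (j + 1) := hmon (by omega)
          have hp : 0 < a (j + 1) + s := add_pos (ha _) hs0
          refine mul_le_mul (hv j) ?_ (norm_nonneg _) hV
          refine (norm_heat_sub_heat_le (add_pos (ha j) hs0) (by linarith)
            hf.aestronglyMeasurable hA x).trans ?_
          refine mul_le_mul_of_nonneg_left (mul_le_mul_of_nonneg_left ?_ (by positivity)) hA0
          rw [one_sub_div hp.ne', add_sub_add_right_eq_sub]
          exact div_le_div_of_nonneg_left (sub_nonneg.2 hjj) hs0 (by linarith [ha (j + 1)])
      _ = V * (A * (2 * d * ((a k - a k₁) / s))) := by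
          rw [← Finset.mul_sum, ← Finset.mul_sum, ← Finset.mul_sum, ← Finset.sum_div,
            Int.sum_Ico_sub a hk₁]
      _ ≤ V * (A * (2 * d * 1)) := by
          gcongr
          rw [div_le_one hs0]
          linarith [ha k₁]
      _ = _ := by ring
  -- From `k` on, second differences are controlled by `s * (1 / a j - 1 / a (j+1))`, which
  -- telescopes to at most `s / a k = 1`.
  have hII : ‖∑ j ∈ Finset.Ico k k₂, (v j : ℂ) * ((heat (a (j + 1)) f x - heat (a j) f x) -
      (heat (a (j + 1) + s) f x - heat (a j + s) f x))‖ ≤ V * A * (16 * d ^ 2) := by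
    calc ‖∑ j ∈ Finset.Ico k k₂, (v j : ℂ) * ((heat (a (j + 1)) f x - heat (a j) f x) -
      (heat (a (j + 1) + s) f x - heat (a j + s) f x))‖
        ≤ ∑ j ∈ Finset.Ico k k₂,
          V * (A * (16 * d ^ 2 * (s * (-(1 / a (j + 1)) - -(1 / a j))))) := by
          refine norm_sum_le_of_le _ fun j hj => ?_
          rw [norm_mul, Complex.norm_real, Real.norm_eq_abs]
          refine mul_le_mul (hv j) ?_ (norm_nonneg _) hV
          refine (norm_heat_second_difference_le (ha j) (hmon (by omega)) hs0 hf hA x).trans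
            (le_of_eq ?_)
          ring
      _ = V * (A * (16 * d ^ 2 * (s * (-(1 / a k₂) - -(1 / a k))))) := by
          rw [← Finset.mul_sum, ← Finset.mul_sum, ← Finset.mul_sum, ← Finset.mul_sum,
            Int.sum_Ico_sub (fun j => -(1 / a j)) hk₂]
      _ ≤ V * (A * (16 * d ^ 2 * 1)) := by
          gcongr
          have h1 : 0 ≤ s * (1 / a k₂) := mul_nonneg hs0.le (one_div_nonneg.2 (ha _).le)
          have h2 : s * (1 / a k) = 1 := mul_one_div_cancel hs0.ne'
          linarith
      _ = _ := by ring
  rw [hcomp, hsplit]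
  have heq : ∑ j ∈ Finset.Ico k k₂, (v j : ℂ) * (heat (a (j + 1)) f x - heat (a j) f x) -
      (∑ j ∈ Finset.Ico k₁ k, (v j : ℂ) * (heat (a (j + 1) + s) f x - heat (a j + s) f x) +
        ∑ j ∈ Finset.Ico k k₂, (v j : ℂ) * (heat (a (j + 1) + s) f x - heat (a j + s) f x)) =
      ∑ j ∈ Finset.Ico k k₂, (v j : ℂ) * ((heat (a (j + 1)) f x - heat (a j) f x) -
        (heat (a (j + 1) + s) f x - heat (a j + s) f x)) -
      ∑ j ∈ Finset.Ico k₁ k, (v j : ℂ) * (heat (a (j + 1) + s) f x - heat (a j + s) f x) := by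
    simp only [mul_sub, Finset.sum_sub_distrib]
    ring
  rw [heq]
  refine (norm_sub_le _ _).trans ((add_le_add hII hI).trans (le_of_eq ?_))
  ring

end Cotlar

/-! ### The part of the function near the ball. -/

section LocalPart

variable {E : Type*} [NormedAddCommGroup E] [InnerProductSpace ℝ E] [FiniteDimensional ℝ E]
  [MeasurableSpace E] [BorelSpace E]

/-- The differential transform of the heat semigroup. -/
noncomputable def heatDiffTransform (v a : ℤ → ℝ) (N : ℤ × ℤ) (f : E → ℂ) (x : E) : ℂ :=
  ∑ j ∈ Finset.Icc N.1 N.2, (v j : ℂ) * (heat (a (j + 1)) f x - heat (a j) f x)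

/-- The maximal differential transform of the heat semigroup. -/
noncomputable def maxHeatDiffTransform (v a : ℤ → ℝ) (f : E → ℂ) (x : E) : ℝ≥0∞ :=
  ⨆ N : {N : ℤ × ℤ // N.1 < N.2}, ‖heatDiffTransform v a N f x‖ₑ

theorem continuous_heatDiffTransform (v : ℤ → ℝ) {a : ℤ → ℝ} (ha : ∀ j, 0 < a j) (N : ℤ × ℤ)
    {f : E → ℂ} (hf : Integrable f) : Continuous (heatDiffTransform v a N f) :=
  continuous_finsetSum _ fun _ _ =>
    continuous_const.mul ((continuous_heat (ha _) hf).sub (continuous_heat (ha _) hf))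

theorem measurable_maxHeatDiffTransform (v : ℤ → ℝ) {a : ℤ → ℝ} (ha : ∀ j, 0 < a j)
    {f : E → ℂ} (hf : Integrable f) : Measurable (maxHeatDiffTransform v a f) :=
  Measurable.iSup fun N => (continuous_heatDiffTransform v ha N hf).measurable.enorm

/-- The maximal function of the heat semigroup over finitely many times is of weak type `(2, 2)`. -/
theorem measure_sup_norm_heat_gt_le [Nontrivial E] {ι : Type*} (s : Finset ι) {t : ι → ℝ}
    (ht : ∀ k, 0 < t k) {g : E → ℂ} (hg : Integrable g) (hg2 : Integrable fun x => ‖g x‖ ^ 2)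
    {τ : ℝ} (hτ : 0 < τ) :
    volume {x | τ < ((s.sup fun k => ‖heat (t k) g x‖₊ : NNReal) : ℝ)} ≤
      4 ^ Module.finrank ℝ E * ENNReal.ofReal (∫ x, ‖g x‖ ^ 2) * ENNReal.ofReal (τ ^ 2)⁻¹ := by
  have hI : ∫⁻ x, ‖g x‖ₑ ^ 2 = ENNReal.ofReal (∫ x, ‖g x‖ ^ 2) := by
    rw [ofReal_integral_eq_lintegral_ofReal hg2 (Filter.Eventually.of_forall fun x => sq_nonneg _)]
    refine lintegral_congr fun x => ?_
    rw [ENNReal.ofReal_pow (norm_nonneg _), ofReal_norm]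
  have hK0 : ENNReal.ofReal τ ^ 2 ≠ 0 := pow_ne_zero _ (by simpa using hτ)
  have h := measure_exists_average_gt_le (fun x => ‖g x‖ₑ ^ 2) hK0
    (ENNReal.pow_ne_top ENNReal.ofReal_ne_top) (by rw [hI]; exact ENNReal.ofReal_ne_top)
  have hinv : (ENNReal.ofReal τ ^ 2)⁻¹ = ENNReal.ofReal (τ ^ 2)⁻¹ := by
    rw [← ENNReal.ofReal_pow hτ.le, ENNReal.ofReal_inv_of_pos (by positivity)]
  rw [hI, hinv] at h
  refine (measure_mono fun x hx => ?_).trans (h.trans (le_of_eq (by ring)))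
  by_contra hcon
  simp only [Set.mem_ofPred_eq, not_exists, not_and, not_lt] at hcon hx
  refine absurd hx (not_lt.2 ?_)
  rw [← Real.coe_toNNReal τ hτ.le, NNReal.coe_le_coe]
  refine Finset.sup_le fun k _ => ?_
  have := enorm_heat_le_of_average_le (ht k) hg.aestronglyMeasurable hτ hcon
  rw [enorm_eq_nnnorm] at this
  exact ENNReal.coe_le_coe.1 this

/-- The constant in the local estimate for the maximal differential transform. -/
noncomputable def heatLocalConst (d : ℕ) : ℝ :=
  2 * (2 * d + 16 * (d : ℝ) ^ 2 + (1 + 8 ^ d))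

/-- In a finite window every partial sum is a difference of two tails, and each tail is controlled
by the Cotlar inequality and one maximal function `U`. The bound does not involve the window, so the
window can be exhausted afterwards. -/
theorem setLIntegral_window_le [Nontrivial E] {v a : ℤ → ℝ} {V : ℝ} (hV0 : 0 < V)
    (hv : ∀ j, |v j| ≤ V) (ha : ∀ j, 0 < a j) (hmon : Monotone a) {f : E → ℂ} (hf : Integrable f)
    {A : ℝ} (hA0 : 0 < A) (hA : ∀ᵐ y, ‖f y‖ ≤ A) {z : E} {r : ℝ}
    (hfz : ∀ᵐ y, y ∉ Metric.ball z (2 * r) → f y = 0) {k₁ k₂ : ℤ} (hk : k₁ ≤ k₂) :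
    ∫⁻ x in Metric.ball z r, ⨆ N : {N : ℤ × ℤ // k₁ ≤ N.1 ∧ N.1 < N.2 ∧ N.2 < k₂},
      ‖heatDiffTransform v a N f x‖ₑ ≤
      ENNReal.ofReal (heatLocalConst (Module.finrank ℝ E) * (V * A)) *
        volume (Metric.ball z r) := by
  set d := Module.finrank ℝ E with hd
  set m := volume (Metric.ball z r) with hm
  have hmt : m ≠ ∞ := measure_ball_lt_top.ne
  set c : ℝ := 2 * d + 16 * (d : ℝ) ^ 2 with hc
  have hc0 : 0 ≤ c := by positivity
  set S : ℤ → E → ℂ := fun k x => ∑ j ∈ Finset.Ico k k₂,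
    (v j : ℂ) * (heat (a (j + 1)) f x - heat (a j) f x) with hS
  set g := S k₁ with hg
  have hgi : Integrable g := integrable_finsetSum _ fun j _ =>
    ((integrable_heat (ha _) hf).sub (integrable_heat (ha _) hf)).const_mul _
  have hgb : ∀ x, ‖g x‖ ≤ ∑ j ∈ Finset.Ico k₁ k₂, V * (A + A) := fun x =>
    norm_sum_le_of_le _ fun j _ => by
      rw [norm_mul, Complex.norm_real, Real.norm_eq_abs]
      exact mul_le_mul (hv j) ((norm_sub_le _ _).trans
        (add_le_add (norm_heat_le (ha _) hA x) (norm_heat_le (ha _) hA x))) (norm_nonneg _) hV0.le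
  have hg2 := integrable_norm_sq_of_bounded hgi (Filter.Eventually.of_forall hgb)
  set U : E → ℝ := fun x => (((Finset.Icc k₁ k₂).sup fun k => ‖heat (a k) g x‖₊ : NNReal) : ℝ)
    with hU
  have hUm : Measurable U := by
    refine Measurable.coe_nnreal_real (Continuous.measurable ?_)
    exact Continuous.finset_sup_apply fun k _ => (continuous_heat (ha k) hgi).nnnorm
  have hUle : ∀ k ∈ Finset.Icc k₁ k₂, ∀ x, ‖heat (a k) g x‖ ≤ U x := by
    intro k hk x
    exact NNReal.coe_le_coe.2
      (Finset.le_sup (f := fun k => ‖heat (a k) g x‖₊) hk)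
  have hSle : ∀ k ∈ Finset.Icc k₁ k₂, ∀ x, ‖S k x‖ ≤ V * A * c + U x := by
    intro k hk x
    have h1 := norm_tail_sub_heat_le hv ha hmon hf hA (Finset.mem_Icc.1 hk).1
      (Finset.mem_Icc.1 hk).2 x
    have h2 := norm_le_norm_sub_add (S k x) (heat (a k) g x)
    linarith [hUle k hk x]
  have hT : ∀ (N : ℤ × ℤ), k₁ ≤ N.1 → N.1 < N.2 → N.2 < k₂ → ∀ x,
      ‖heatDiffTransform v a N f x‖ ≤ 2 * (V * A * c) + 2 * U x := by
    intro N h1 h2 h3 x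
    -- The sum includes `N.2`, so the second tail starts at `N.2 + 1`; this stays in the window
    -- because `N.2 < k₂`.
    have h4 : heatDiffTransform v a N f x = S N.1 x - S (N.2 + 1) x := by
      rw [eq_sub_iff_add_eq, heatDiffTransform, Int.Icc_eq_Ico_add_one, hS]
      simp only
      rw [← Finset.Ico_union_Ico_eq_Ico (show N.1 ≤ N.2 + 1 by omega)
        (show N.2 + 1 ≤ k₂ by omega),
        Finset.sum_union (Finset.Ico_disjoint_Ico_consecutive _ _ _)]
    rw [h4]
    have h5 := hSle N.1 (Finset.mem_Icc.2 ⟨h1, by omega⟩) x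
    have h6 := hSle (N.2 + 1) (Finset.mem_Icc.2 ⟨by omega, by omega⟩) x
    linarith [norm_sub_le (S N.1 x) (S (N.2 + 1) x)]
  have hf1 : ∫ x, ‖f x‖ ≤ A * (2 ^ d * m.toReal) := by
    have h1 : ∫ x, ‖f x‖ ≤ ∫ x, (Metric.ball z (2 * r)).indicator (fun _ => A) x := by
      refine integral_mono_ae hf.norm ((integrable_indicator_iff measurableSet_ball).2
        (integrableOn_const measure_ball_lt_top.ne)) ?_
      filter_upwards [hA, hfz] with y hy hyz
      by_cases h : y ∈ Metric.ball z (2 * r)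
      · rwa [Set.indicator_of_mem h]
      · rw [Set.indicator_of_notMem h, hyz h, norm_zero]
    refine h1.trans (le_of_eq ?_)
    rw [integral_indicator measurableSet_ball, setIntegral_const, Measure.real,
      Measure.addHaar_ball_mul volume _ (by norm_num : (0 : ℝ) ≤ 2), ENNReal.toReal_mul,
      ENNReal.toReal_ofReal (by positivity), ← Measure.addHaar_ball_center volume z, smul_eq_mul]
    ring
  have hgL2 : ∫ x, ‖g x‖ ^ 2 ≤ (V * A) ^ 2 * (2 ^ d * m.toReal) := by
    refine (integral_norm_sq_sum_heat_sub_le hv ha hmon hf hA hk).trans ?_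
    calc V ^ 2 * (A * ∫ x, ‖f x‖) ≤ V ^ 2 * (A * (A * (2 ^ d * m.toReal))) := by gcongr
      _ = _ := by ring
  have hVA : 0 < V * A := mul_pos hV0 hA0
  -- Kolmogorov's inequality at height `V * A`, which balances both terms; `8^d` is the weak type
  -- constant `4^d` times the volume ratio `2^d`.
  have hUint : ∫⁻ x in Metric.ball z r, ENNReal.ofReal (U x) ≤
      ENNReal.ofReal ((1 + 8 ^ d) * (V * A)) * m := by
    refine (setLIntegral_le_of_weakL2 hUm (fun x => NNReal.coe_nonneg _)
      (fun t ht => measure_sup_norm_heat_gt_le _ ha hgi hg2 ht) (Metric.ball z r) hVA).trans ?_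
    have h1 : 4 ^ d * ENNReal.ofReal (∫ x, ‖g x‖ ^ 2) * ENNReal.ofReal (V * A)⁻¹ ≤
        ENNReal.ofReal (8 ^ d * (V * A)) * m := by
      calc 4 ^ d * ENNReal.ofReal (∫ x, ‖g x‖ ^ 2) * ENNReal.ofReal (V * A)⁻¹
          ≤ ENNReal.ofReal (4 ^ d) * ENNReal.ofReal ((V * A) ^ 2 * (2 ^ d * m.toReal)) *
            ENNReal.ofReal (V * A)⁻¹ := by
            gcongr
            rw [ENNReal.ofReal_pow (by norm_num)]
            simp
        _ = ENNReal.ofReal (8 ^ d * (V * A) * m.toReal) := by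
            rw [← ENNReal.ofReal_mul (by positivity), ← ENNReal.ofReal_mul (by positivity)]
            congr 1
            rw [show (8 : ℝ) = 4 * 2 by norm_num, mul_pow 4]
            field_simp
        _ = _ := by rw [ENNReal.ofReal_mul (by positivity), ENNReal.ofReal_toReal hmt]
    calc m * ENNReal.ofReal (V * A) +
          4 ^ d * ENNReal.ofReal (∫ x, ‖g x‖ ^ 2) * ENNReal.ofReal (V * A)⁻¹
        ≤ m * ENNReal.ofReal (V * A) + ENNReal.ofReal (8 ^ d * (V * A)) * m := by gcongr
      _ = _ := by
          rw [mul_comm m, ← add_mul, ← ENNReal.ofReal_add hVA.le (by positivity)]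
          congr 2; ring
  calc ∫⁻ x in Metric.ball z r, ⨆ N : {N : ℤ × ℤ // k₁ ≤ N.1 ∧ N.1 < N.2 ∧ N.2 < k₂},
        ‖heatDiffTransform v a N f x‖ₑ
      ≤ ∫⁻ x in Metric.ball z r,
          (ENNReal.ofReal (2 * (V * A * c)) + 2 * ENNReal.ofReal (U x)) := by
        refine lintegral_mono fun x => iSup_le fun N => ?_
        rw [← ofReal_norm, show (2 : ℝ≥0∞) = ENNReal.ofReal 2 by simp,
          ← ENNReal.ofReal_mul (by norm_num),
          ← ENNReal.ofReal_add (by positivity) (mul_nonneg (by norm_num) (NNReal.coe_nonneg _))]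
        exact ENNReal.ofReal_le_ofReal (hT N N.2.1 N.2.2.1 N.2.2.2 x)
    _ = ENNReal.ofReal (2 * (V * A * c)) * m +
          2 * ∫⁻ x in Metric.ball z r, ENNReal.ofReal (U x) := by
        rw [lintegral_add_left measurable_const, lintegral_const_mul _ hUm.ennreal_ofReal,
          setLIntegral_const]
    _ ≤ ENNReal.ofReal (2 * (V * A * c)) * m +
          2 * (ENNReal.ofReal ((1 + 8 ^ d) * (V * A)) * m) := by gcongr
    _ = _ := by
        rw [← mul_assoc 2 (ENNReal.ofReal _) m, ← add_mul, show (2 : ℝ≥0∞) = ENNReal.ofReal 2 by simp,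
          ← ENNReal.ofReal_mul (by norm_num), ← ENNReal.ofReal_add (by positivity) (by positivity),
          heatLocalConst]
        congr 2
        ring

theorem setLIntegral_maxHeatDiffTransform_le_of_local [Nontrivial E] {v a : ℤ → ℝ} {V : ℝ}
    (hV0 : 0 < V) (hv : ∀ j, |v j| ≤ V) (ha : ∀ j, 0 < a j) (hmon : Monotone a) {f : E → ℂ}
    (hf : Integrable f) {A : ℝ} (hA0 : 0 < A) (hA : ∀ᵐ y, ‖f y‖ ≤ A) {z : E} {r : ℝ}
    (hfz : ∀ᵐ y, y ∉ Metric.ball z (2 * r) → f y = 0) :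
    ∫⁻ x in Metric.ball z r, maxHeatDiffTransform v a f x ≤
      ENNReal.ofReal (heatLocalConst (Module.finrank ℝ E) * (V * A)) *
        volume (Metric.ball z r) := by
  set G : ℕ → E → ℝ≥0∞ := fun M x =>
    ⨆ N : {N : ℤ × ℤ // -(M : ℤ) ≤ N.1 ∧ N.1 < N.2 ∧ N.2 < (M : ℤ)},
      ‖heatDiffTransform v a N f x‖ₑ with hG
  have hGm : ∀ M, Measurable (G M) := fun M =>
    Measurable.iSup fun N => (continuous_heatDiffTransform v ha N hf).measurable.enorm
  have hGmono : Monotone G := by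
    intro M M' hM x
    refine iSup_le fun N => ?_
    have hM' : (M : ℤ) ≤ M' := by exact_mod_cast hM
    exact le_iSup (fun N : {N : ℤ × ℤ // -(M' : ℤ) ≤ N.1 ∧ N.1 < N.2 ∧ N.2 < (M' : ℤ)} =>
      ‖heatDiffTransform v a N f x‖ₑ)
      ⟨N.1, by linarith [N.2.1], N.2.2.1, by linarith [N.2.2.2]⟩
  have hle : ∀ x, maxHeatDiffTransform v a f x ≤ ⨆ M, G M x := by
    intro x
    refine iSup_le fun N => ?_
    refine le_iSup_of_le (N.1.1.natAbs + N.1.2.natAbs + 1) ?_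
    exact le_iSup (fun N' : {N' : ℤ × ℤ // -((N.1.1.natAbs + N.1.2.natAbs + 1 : ℕ) : ℤ) ≤ N'.1 ∧
      N'.1 < N'.2 ∧ N'.2 < ((N.1.1.natAbs + N.1.2.natAbs + 1 : ℕ) : ℤ)} =>
      ‖heatDiffTransform v a N' f x‖ₑ) ⟨N.1, by omega, N.2, by omega⟩
  refine (lintegral_mono hle).trans ?_
  rw [lintegral_iSup hGm hGmono]
  exact iSup_le fun M => setLIntegral_window_le hV0 hv ha hmon hf hA0 hA hfz (by omega)

end LocalPart

/-! ### The logarithmic estimate for the heat semigroup. -/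

section HeatTheorem

variable {E : Type*} [NormedAddCommGroup E] [InnerProductSpace ℝ E] [FiniteDimensional ℝ E]
  [MeasurableSpace E] [BorelSpace E]

theorem maxHeatDiffTransform_add_le (v : ℤ → ℝ) {a : ℤ → ℝ} (ha : ∀ j, 0 < a j) {f g : E → ℂ}
    {A : ℝ} (hf : AEStronglyMeasurable f) (hfA : ∀ᵐ y, ‖f y‖ ≤ A) (hg : AEStronglyMeasurable g)
    (hgA : ∀ᵐ y, ‖g y‖ ≤ A) (x : E) :
    maxHeatDiffTransform v a (fun y => f y + g y) x ≤
      maxHeatDiffTransform v a f x + maxHeatDiffTransform v a g x := by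
  have hadd : ∀ t, 0 < t → heat t (fun y => f y + g y) x = heat t f x + heat t g x := by
    intro t ht
    unfold heat
    rw [← integral_add (integrable_mul_heatKernel ht hf hfA x)
      (integrable_mul_heatKernel ht hg hgA x)]
    simp only [add_mul]
  refine iSup_le fun N => ?_
  have h : heatDiffTransform v a N (fun y => f y + g y) x =
      heatDiffTransform v a N f x + heatDiffTransform v a N g x := by
    unfold heatDiffTransform
    rw [← Finset.sum_add_distrib]
    refine Finset.sum_congr rfl fun j _ => ?_
    rw [hadd _ (ha _), hadd _ (ha _)]
    ring
  rw [h]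
  exact (enorm_add_le _ _).trans (add_le_add
    (le_iSup (fun N : {N : ℤ × ℤ // N.1 < N.2} => ‖heatDiffTransform v a N f x‖ₑ) N)
    (le_iSup (fun N : {N : ℤ × ℤ // N.1 < N.2} => ‖heatDiffTransform v a N g x‖ₑ) N))

/-- The constant in the logarithmic growth estimate, in dimension `d` with unit ball of volume
`V`. -/
noncomputable def heatMaxConst (d : ℕ) (V : ℝ) : ℝ :=
  heatLocalConst d + 2 * max 1 (heatFarConst d V)

theorem heatMaxConst_pos (d : ℕ) (V : ℝ) : 0 < heatMaxConst d V := by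
  have h1 : 0 < heatLocalConst d := by unfold heatLocalConst; positivity
  have h2 : 1 ≤ max 1 (heatFarConst d V) := le_max_left _ _
  unfold heatMaxConst
  linarith

theorem maxHeatDiffTransform_le_of_far [Nontrivial E] {p q : ℝ≥0∞} (hp : 1 ≤ p)
    (hpq : ENNReal.HolderConjugate p q) (v : lp (fun _ : ℤ => ℝ) p) {a : ℤ → ℝ}
    (ha : ∀ j, 0 < a j) (hmon : Monotone a) {f : E → ℂ} (hf : AEStronglyMeasurable f) {A : ℝ}
    (hA : ∀ᵐ y, ‖f y‖ ≤ A) {x : E} {r : ℝ} (hr : 0 < r) (hr2 : r ≤ 2)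
    (hfx : ∀ᵐ y, ‖x - y‖ ∉ Set.Ico r 2 → f y = 0) :
    maxHeatDiffTransform (fun j => v j) a f x ≤ ENNReal.ofReal
      (2 * (heatFarConst (Module.finrank ℝ E) (volume.real (Metric.ball (0 : E) 1)) *
        Real.log (2 / r)) ^ (1 / q).toReal * ‖v‖ * A) := by
  have hA0 : 0 ≤ A := (norm_nonneg _).trans (norm_heat_le (ha 0) hA 0)
  have hL : 0 ≤ Real.log (2 / r) := Real.log_nonneg ((one_le_div hr).2 hr2)
  refine iSup_le fun N => ?_
  rw [← ofReal_norm]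
  refine ENNReal.ofReal_le_ofReal ?_
  calc ‖heatDiffTransform (fun j => v j) a N f x‖
      ≤ ∑ j ∈ Finset.Icc N.1.1 N.1.2, |v j| * ‖heat (a (j + 1)) f x - heat (a j) f x‖ := by
        refine norm_sum_le_of_le _ fun j _ => ?_
        rw [norm_mul, Complex.norm_real, Real.norm_eq_abs]
    _ ≤ _ := by
        refine lp_sum_abs_mul_le hp hpq v hA0 (mul_nonneg ?_ hL) _ (fun j => norm_nonneg _)
          (fun j => ?_) (sum_norm_heat_sub_le_of_far ha hmon hf hA hr hr2 hfx _ _)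
        · unfold heatFarConst; positivity
        · refine (norm_sub_le _ _).trans ?_
          linarith [norm_heat_le (ha (j + 1)) hA x, norm_heat_le (ha j) hA x]

theorem setLIntegral_maxHeatDiffTransform_le [Nontrivial E] {p q : ℝ≥0∞} (hp : 1 ≤ p)
    (hpq : ENNReal.HolderConjugate p q) (v : lp (fun _ : ℤ => ℝ) p) (hv : 0 < ‖v‖) {a : ℤ → ℝ}
    (ha : ∀ j, 0 < a j) (hmon : Monotone a) {f : E → ℂ} (hf : Integrable f) {A : ℝ} (hA0 : 0 < A)
    (hA : ∀ᵐ y, ‖f y‖ ≤ A) (hfB : ∀ᵐ y, y ∉ Metric.ball (0 : E) 1 → f y = 0) {z : E} {r : ℝ}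
    (hr : 0 < r) (hr2 : 2 * r < 1) (hball : Metric.ball z r ⊆ Metric.ball 0 1) :
    ∫⁻ x in Metric.ball z r, maxHeatDiffTransform (fun j => v j) a f x ≤
      ENNReal.ofReal (heatMaxConst (Module.finrank ℝ E) (volume.real (Metric.ball (0 : E) 1)) *
        Real.log (2 / r) ^ (1 / q).toReal * ‖v‖ * A) * volume (Metric.ball z r) := by
  set K := heatFarConst (Module.finrank ℝ E) (volume.real (Metric.ball (0 : E) 1)) with hK
  set θ := (1 / q).toReal with hθ
  set L := Real.log (2 / r) with hL
  set D := Metric.ball z (2 * r) with hD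
  have hK0 : 0 ≤ K := by rw [hK]; unfold heatFarConst; positivity
  have hθ0 : 0 ≤ θ := ENNReal.toReal_nonneg
  have hθ1 : θ ≤ 1 := by
    have h1 : 1 / q ≤ 1 := by
      have h2 := hpq.inv_add_inv_eq_inv
      rw [inv_one] at h2
      rw [one_div, ← h2]
      exact le_add_self
    exact (ENNReal.toReal_mono ENNReal.one_ne_top h1).trans_eq ENNReal.toReal_one
  -- Here `2 / r > 4 > e`; this is what lets the logarithm absorb the local constant.
  have hL1 : 1 ≤ L := by
    have h1 : Real.exp 1 ≤ 2 / r := by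
      rw [le_div_iff₀ hr]
      nlinarith [Real.exp_one_lt_d9, Real.exp_pos 1]
    simpa using Real.log_le_log (Real.exp_pos 1) h1
  have hLθ : 1 ≤ L ^ θ := Real.one_le_rpow hL1 hθ0
  -- Replacing `K^θ` by `max 1 K` makes the constant independent of the exponent.
  have hKL : (K * L) ^ θ ≤ max 1 K * L ^ θ := by
    rw [Real.mul_rpow hK0 (by linarith)]
    gcongr
    calc K ^ θ ≤ (max 1 K) ^ θ := Real.rpow_le_rpow hK0 (le_max_right _ _) hθ0
      _ ≤ (max 1 K) ^ (1 : ℝ) := Real.rpow_le_rpow_of_exponent_le (le_max_left _ _) hθ1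
      _ = _ := Real.rpow_one _
  have hvA : 0 < ‖v‖ * A := mul_pos hv hA0
  set f₁ := D.indicator f with hf₁
  set f₂ := Dᶜ.indicator f with hf₂
  have hsum : f = fun y => f₁ y + f₂ y := by
    ext y
    by_cases hy : y ∈ D
    · simp [hf₁, hf₂, hy]
    · simp [hf₁, hf₂, hy]
  have hf₁i : Integrable f₁ := hf.indicator measurableSet_ball
  have hf₂i : Integrable f₂ := hf.indicator measurableSet_ball.compl
  have hf₁A : ∀ᵐ y, ‖f₁ y‖ ≤ A := by
    filter_upwards [hA] with y hy using (norm_indicator_le_norm_self _ _).trans hy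
  have hf₂A : ∀ᵐ y, ‖f₂ y‖ ≤ A := by
    filter_upwards [hA] with y hy using (norm_indicator_le_norm_self _ _).trans hy
  have hlocal := setLIntegral_maxHeatDiffTransform_le_of_local hv
    (fun j => lp.norm_apply_le_norm (zero_lt_one.trans_le hp).ne' v j) ha hmon hf₁i hA0 hf₁A
    (z := z) (r := r)
    (Filter.Eventually.of_forall fun y hy => Set.indicator_of_notMem hy f)
  have hfar : ∀ x ∈ Metric.ball z r, maxHeatDiffTransform (fun j => v j) a f₂ x ≤
      ENNReal.ofReal (2 * (K * L) ^ θ * ‖v‖ * A) := by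
    intro x hx
    refine maxHeatDiffTransform_le_of_far hp hpq v ha hmon hf₂i.aestronglyMeasurable hf₂A hr
      (by linarith) ?_
    filter_upwards [hfB] with y hy hxy
    by_contra hne
    have hyD : y ∈ Dᶜ := by
      by_contra h
      exact hne (Set.indicator_of_notMem h f)
    have hfy : f y ≠ 0 := by
      intro h
      exact hne (by rw [hf₂, Set.indicator_of_mem hyD, h])
    have hyB : y ∈ Metric.ball (0 : E) 1 := by
      by_contra h
      exact hfy (hy h)
    -- The lower bound comes from `x ∈ B(z, r)` and `y ∉ B(z, 2r)`, the upper one from both points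
    -- lying in the unit ball.
    refine hxy ⟨?_, ?_⟩
    · by_contra h
      refine hyD ?_
      rw [hD, Metric.mem_ball]
      have h1 : dist y x < r := by rw [dist_comm, dist_eq_norm]; exact not_le.1 h
      have h2 := dist_triangle y x z
      have h3 := Metric.mem_ball.1 hx
      linarith
    · have h1 := mem_ball_zero_iff.1 (hball hx)
      have h2 := mem_ball_zero_iff.1 hyB
      linarith [norm_sub_le x y]
  calc ∫⁻ x in Metric.ball z r, maxHeatDiffTransform (fun j => v j) a f x
      ≤ ∫⁻ x in Metric.ball z r, (maxHeatDiffTransform (fun j => v j) a f₁ x +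
          ENNReal.ofReal (2 * (K * L) ^ θ * ‖v‖ * A)) := by
        refine setLIntegral_mono' measurableSet_ball fun x hx => ?_
        conv_lhs => rw [hsum]
        exact (maxHeatDiffTransform_add_le _ ha hf₁i.aestronglyMeasurable hf₁A
          hf₂i.aestronglyMeasurable hf₂A x).trans (add_le_add le_rfl (hfar x hx))
    _ = (∫⁻ x in Metric.ball z r, maxHeatDiffTransform (fun j => v j) a f₁ x) +
          ENNReal.ofReal (2 * (K * L) ^ θ * ‖v‖ * A) * volume (Metric.ball z r) := by
        rw [lintegral_add_right _ measurable_const, setLIntegral_const]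
    _ ≤ ENNReal.ofReal (heatLocalConst (Module.finrank ℝ E) * (‖v‖ * A)) *
          volume (Metric.ball z r) +
          ENNReal.ofReal (2 * (K * L) ^ θ * ‖v‖ * A) * volume (Metric.ball z r) := by gcongr
    _ ≤ _ := by
        have hc0 : 0 ≤ heatLocalConst (Module.finrank ℝ E) := by unfold heatLocalConst; positivity
        have hKL0 : 0 ≤ (K * L) ^ θ := Real.rpow_nonneg (mul_nonneg hK0 (by linarith)) _
        rw [← add_mul, ← ENNReal.ofReal_add (by positivity) (by positivity)]
        gcongr
        unfold heatMaxConst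
        calc heatLocalConst (Module.finrank ℝ E) * (‖v‖ * A) + 2 * (K * L) ^ θ * ‖v‖ * A
            = (heatLocalConst (Module.finrank ℝ E) * 1 + 2 * (K * L) ^ θ) * (‖v‖ * A) := by ring
          _ ≤ (heatLocalConst (Module.finrank ℝ E) * L ^ θ + 2 * (max 1 K * L ^ θ)) *
                (‖v‖ * A) := by gcongr
          _ = _ := by ring

end HeatTheorem

/-! ### Discrete subordination of the fractional semigroup. -/

section Subordination

variable {E : Type*} [NormedAddCommGroup E] [InnerProductSpace ℝ E] [FiniteDimensional ℝ E]
  [MeasurableSpace E] [BorelSpace E]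

theorem integrable_exp_neg_mul_norm_rpow [Nontrivial E] {b c : ℝ} (hb : 0 < b) (hc : 0 < c) :
    Integrable (fun ξ : E => Real.exp (-b * ‖ξ‖ ^ c)) := by
  rw [integrable_fun_norm_addHaar volume (f := fun ρ : ℝ => Real.exp (-b * ρ ^ c))]
  have h := integrableOn_rpow_mul_exp_neg_mul_rpow (p := c) (b := b)
    (s := ((Module.finrank ℝ E - 1 : ℕ) : ℝ)) (by
      have : (0 : ℝ) ≤ ((Module.finrank ℝ E - 1 : ℕ) : ℝ) := Nat.cast_nonneg _
      linarith) hc hb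
  simpa only [Real.rpow_natCast, smul_eq_mul] using h

theorem sq_rpow_eq {α x : ℝ} (hx : 0 ≤ x) : (x ^ 2) ^ α = x ^ (2 * α) := by
  rw [Real.rpow_mul hx, Real.rpow_two]

theorem rpow_inv_mul_rpow {α t x : ℝ} (hα0 : 0 < α) (ht : 0 ≤ t) (hx : 0 ≤ x) :
    (t ^ α⁻¹ * x ^ 2) ^ α = t * x ^ (2 * α) := by
  rw [Real.mul_rpow (Real.rpow_nonneg ht _) (sq_nonneg _), ← Real.rpow_mul ht,
    inv_mul_cancel₀ hα0.ne', Real.rpow_one, sq_rpow_eq hx]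

theorem continuous_sibuyaLaplace {α : ℝ} (hα0 : 0 < α) (m : ℕ) :
    Continuous (sibuyaLaplace α m) := by
  unfold sibuyaLaplace
  refine Continuous.pow (continuous_const.sub (Continuous.rpow_const ?_ fun _ => Or.inr hα0.le)) m
  fun_prop

theorem integrable_exp_fracSymbol [Nontrivial E] {α t : ℝ} (hα0 : 0 < α) (ht : 0 < t) :
    Integrable (fun ξ : E => Real.exp (-(t ^ α⁻¹ * (2 * Real.pi * ‖ξ‖) ^ 2 / 2) ^ α)) := by
  have hb : 0 < t * (2 * Real.pi) ^ (2 * α) / 2 ^ α := by positivity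
  refine (integrable_exp_neg_mul_norm_rpow (E := E) hb
    (show 0 < 2 * α by positivity)).congr (Filter.Eventually.of_forall fun ξ => ?_)
  simp only
  rw [Real.div_rpow (by positivity) (by norm_num), rpow_inv_mul_rpow hα0 ht.le (by positivity),
    Real.mul_rpow (by positivity) (norm_nonneg _)]
  congr 1
  ring

theorem norm_sibuya_symbol_le {α : ℝ} (hα0 : 0 < α) (hα1 : α < 1) {m : ℕ} (hm : 1 ≤ m) {t : ℝ}
    (ht : 0 < t) (f : E → ℂ) (ξ : E) :
    sibuyaLaplace α m (t ^ α⁻¹ * (2 * Real.pi * ‖ξ‖) ^ 2) * ‖𝓕 f ξ‖ ≤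
      Real.exp (-(t ^ α⁻¹ * (2 * Real.pi * ‖ξ‖) ^ 2 / 2) ^ α) * ∫ x, ‖f x‖ := by
  have h := sibuyaLaplace_le hα0 hα1 hm (lam := t ^ α⁻¹ * (2 * Real.pi * ‖ξ‖) ^ 2) (by positivity)
  exact mul_le_mul h (norm_fourier_le_integral f ξ) (norm_nonneg _) (Real.exp_pos _).le

theorem aestronglyMeasurable_sibuya_symbol {α : ℝ} (hα0 : 0 < α) (m : ℕ) (t : ℝ) {f : E → ℂ}
    (hf : Integrable f) (x : E) : AEStronglyMeasurable (fun ξ : E => 𝐞 (inner ℝ ξ x) •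
      ((sibuyaLaplace α m (t ^ α⁻¹ * (2 * Real.pi * ‖ξ‖) ^ 2) : ℂ) * 𝓕 f ξ)) := by
  have h1 := continuous_fourier_of_integrable hf
  have h2 := continuous_sibuyaLaplace hα0 m
  have h3 := Real.continuous_fourierChar
  refine Continuous.aestronglyMeasurable ?_
  simp only [Circle.smul_def, smul_eq_mul]
  fun_prop

/-- Termwise inverse Fourier transform of the expansion of the symbol. The terms are nonnegative
multiples of `‖𝓕 f‖`, so the sum of their norms is the full symbol times `‖𝓕 f‖`, which is
integrable. -/
theorem hasSum_mul_heat [Nontrivial E] {α : ℝ} (hα0 : 0 < α) (hα1 : α < 1) {m : ℕ} (hm : 1 ≤ m)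
    {w : ℕ → ℝ} (hw0 : ∀ i, 0 ≤ w i) (hw00 : w 0 = 0)
    (hw : ∀ lam : ℝ, 0 < lam → HasSum (fun i => w i * Real.exp (-(i * (m : ℝ) ^ (-α⁻¹) * lam)))
      (sibuyaLaplace α m lam)) {t : ℝ} (ht : 0 < t) {f : E → ℂ} (hf : Integrable f) (x : E) :
    HasSum (fun i : ℕ => (w i : ℂ) * heat (i * (m : ℝ) ^ (-α⁻¹) * t ^ α⁻¹) f x)
      (𝓕⁻ (fun ξ : E => (sibuyaLaplace α m (t ^ α⁻¹ * (2 * Real.pi * ‖ξ‖) ^ 2) : ℂ) * 𝓕 f ξ) x) := by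
  set δ := (m : ℝ) ^ (-α⁻¹) with hδ
  have hδ0 : 0 < δ := Real.rpow_pos_of_pos (by exact_mod_cast hm) _
  set τ := t ^ α⁻¹ with hτ
  have hτ0 : 0 < τ := Real.rpow_pos_of_pos ht _
  set e : ℕ → E → ℝ := fun i ξ => w i * Real.exp (-(i * δ * (τ * (2 * Real.pi * ‖ξ‖) ^ 2))) with he
  have he0 : ∀ i ξ, 0 ≤ e i ξ := fun i ξ => mul_nonneg (hw0 i) (Real.exp_pos _).le
  have hterm : ∀ i : ℕ, (w i : ℂ) * heat (i * δ * τ) f x =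
      ∫ ξ : E, 𝐞 (inner ℝ ξ x) • ((e i ξ : ℂ) * 𝓕 f ξ) := by
    intro i
    -- At `i = 0` the time is zero and `heat` is not the semigroup; the vanishing weight removes the
    -- term.
    rcases Nat.eq_zero_or_pos i with rfl | hi
    · simp [he, hw00]
    · have hi0 : (0 : ℝ) < i := by exact_mod_cast hi
      rw [← fourierInv_heatSymbol_mul_fourier (by positivity) hf, Real.fourierInv_eq,
        ← integral_const_mul]
      refine integral_congr_ae (Filter.Eventually.of_forall fun ξ => ?_)
      simp only [he, Circle.smul_def, smul_eq_mul]
      rw [Complex.ofReal_mul, show -(↑i * δ * (τ * (2 * Real.pi * ‖ξ‖) ^ 2)) =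
        -(↑i * δ * τ) * (2 * Real.pi * ‖ξ‖) ^ 2 by ring]
      ring
  simp only [hterm]
  rw [Real.fourierInv_eq]
  have hsum : ∀ᵐ ξ : E, HasSum (fun i => e i ξ)
      (sibuyaLaplace α m (τ * (2 * Real.pi * ‖ξ‖) ^ 2)) := by
    -- At `ξ = 0` the expansion is unavailable, since it is only known for `lam > 0`.
    have : ∀ᵐ ξ : E, ξ ≠ 0 := by simp [ae_iff]
    filter_upwards [this] with ξ hξ
    have h0 : 0 < ‖ξ‖ := norm_pos_iff.2 hξ
    exact hw _ (by positivity)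
  have hnorm : ∀ i ξ, ‖𝐞 (inner ℝ ξ x) • ((e i ξ : ℂ) * 𝓕 f ξ)‖ = e i ξ * ‖𝓕 f ξ‖ := by
    intro i ξ
    rw [Circle.norm_smul, norm_mul, Complex.norm_real, Real.norm_of_nonneg (he0 i ξ)]
  have hFc := continuous_fourier_of_integrable hf
  refine hasSum_integral_of_dominated_convergence (fun i ξ => e i ξ * ‖𝓕 f ξ‖) (fun i => ?_)
    (fun i => Filter.Eventually.of_forall fun ξ => (hnorm i ξ).le) ?_ ?_ ?_
  · refine Continuous.aestronglyMeasurable ?_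
    have h3 := Real.continuous_fourierChar
    simp only [Circle.smul_def, smul_eq_mul, he]
    fun_prop
  · filter_upwards [hsum] with ξ hξ using hξ.summable.mul_right _
  · have hdom := (integrable_exp_fracSymbol (E := E) hα0 ht).mul_const (∫ x, ‖f x‖)
    have hi : Integrable (fun ξ : E =>
        sibuyaLaplace α m (τ * (2 * Real.pi * ‖ξ‖) ^ 2) * ‖𝓕 f ξ‖) := by
      refine hdom.mono' ?_ (Filter.Eventually.of_forall fun ξ => ?_)
      · have h2 := continuous_sibuyaLaplace hα0 m
        exact Continuous.aestronglyMeasurable (by fun_prop)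
      · rw [Real.norm_of_nonneg (mul_nonneg (sibuyaLaplace_nonneg hα0 m (by positivity))
          (norm_nonneg _))]
        exact norm_sibuya_symbol_le hα0 hα1 hm ht f ξ
    refine hi.congr ?_
    filter_upwards [hsum] with ξ hξ
    exact (hξ.mul_right _).tsum_eq.symm
  · filter_upwards [hsum] with ξ hξ
    exact ((Complex.hasSum_ofReal.2 hξ).mul_right _).const_smul (𝐞 (inner ℝ ξ x))

variable {n : ℕ}

/-- Dominated convergence with the majorant uniform in `m`; at `lam = t^(1/α) |2πξ|²` the limit
symbol is the fractional one. -/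
theorem tendsto_fourierInv_sibuya [Nontrivial (EuclideanSpace ℝ (Fin n))] {α : ℝ} (hα0 : 0 < α)
    (hα1 : α < 1) {t : ℝ} (ht : 0 < t) {f : EuclideanSpace ℝ (Fin n) → ℂ} (hf : Integrable f)
    (x : EuclideanSpace ℝ (Fin n)) :
    Filter.Tendsto (fun m : ℕ => 𝓕⁻ (fun ξ : EuclideanSpace ℝ (Fin n) =>
      (sibuyaLaplace α (m + 1) (t ^ α⁻¹ * (2 * Real.pi * ‖ξ‖) ^ 2) : ℂ) * 𝓕 f ξ) x)
      Filter.atTop (nhds (fracHeat α t f x)) := by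
  unfold fracHeat
  simp only [Real.fourierInv_eq]
  refine tendsto_integral_of_dominated_convergence _
    (fun m => aestronglyMeasurable_sibuya_symbol hα0 (m + 1) t hf x)
    ((integrable_exp_fracSymbol (E := EuclideanSpace ℝ (Fin n)) hα0 ht).mul_const (∫ x, ‖f x‖))
    (fun m => Filter.Eventually.of_forall fun ξ => ?_)
    (Filter.Eventually.of_forall fun ξ => ?_)
  · rw [Circle.norm_smul, norm_mul, Complex.norm_real,
      Real.norm_of_nonneg (sibuyaLaplace_nonneg hα0 _ (by positivity))]
    exact norm_sibuya_symbol_le hα0 hα1 (Nat.le_add_left _ _) ht f ξ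
  · have h := (Filter.tendsto_add_atTop_iff_nat 1).2
      (tendsto_sibuyaLaplace hα0 (lam := t ^ α⁻¹ * (2 * Real.pi * ‖ξ‖) ^ 2) (by positivity))
    rw [rpow_inv_mul_rpow hα0 ht.le (by positivity), ← neg_mul] at h
    have h2 := (Complex.continuous_ofReal.tendsto _).comp h
    exact (h2.mul_const (𝓕 f ξ)).const_smul (𝐞 (inner ℝ ξ x))

/-- Subordination: the maximal differential transform of the fractional heat semigroup is dominated
by mixtures of maximal differential transforms of the heat semigroup. -/
theorem exists_maxDiffTransform_le_liminf [Nontrivial (EuclideanSpace ℝ (Fin n))] {α : ℝ}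
    (hα0 : 0 < α) (hα1 : α < 1) :
    ∃ w : ℕ → ℕ → ℝ, (∀ m i, 0 ≤ w m i) ∧ (∀ m, w m 0 = 0) ∧
      (∀ m, ∑' i, ENNReal.ofReal (w m i) ≤ 1) ∧
      ∀ (v a : ℤ → ℝ) (_ : ∀ j, 0 < a j) (f : EuclideanSpace ℝ (Fin n) → ℂ) (_ : Integrable f)
        (x : EuclideanSpace ℝ (Fin n)), maxDiffTransform α v a f x ≤
          Filter.liminf (fun m : ℕ => ∑' i : ℕ, ENNReal.ofReal (w m i) *
            maxHeatDiffTransform v (fun j => i * ((m + 1 : ℕ) : ℝ) ^ (-α⁻¹) * a j ^ α⁻¹) f x)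
            Filter.atTop := by
  choose w hw0 hw00 hws hw1 hw using fun m : ℕ =>
    exists_sibuyaLaplace_hasSum hα0 hα1 (Nat.le_add_left 1 m)
  refine ⟨w, hw0, hw00, fun m => ?_, fun v a ha f hf x => iSup_le fun N => ?_⟩
  · rw [← ENNReal.ofReal_tsum_of_nonneg (hw0 m) (hws m)]
    exact ENNReal.ofReal_le_one.2 (hw1 m)
  · set P : ℕ → ℝ → ℂ := fun m t => 𝓕⁻ (fun ξ : EuclideanSpace ℝ (Fin n) =>
      (sibuyaLaplace α (m + 1) (t ^ α⁻¹ * (2 * Real.pi * ‖ξ‖) ^ 2) : ℂ) * 𝓕 f ξ) x with hP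
    have hlim : Filter.Tendsto
        (fun m => ∑ j ∈ Finset.Icc N.1.1 N.1.2, (v j : ℂ) * (P m (a (j + 1)) - P m (a j)))
        Filter.atTop (nhds (diffTransform α v a N f x)) :=
      tendsto_finsetSum _ fun j _ => ((tendsto_fourierInv_sibuya hα0 hα1 (ha _) hf x).sub
        (tendsto_fourierInv_sibuya hα0 hα1 (ha _) hf x)).const_mul _
    rw [← hlim.enorm.liminf_eq]
    refine Filter.liminf_le_liminf (Filter.Eventually.of_forall fun m => ?_)
    have hsum : HasSum (fun i : ℕ => (w m i : ℂ) * heatDiffTransform v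
        (fun j => i * ((m + 1 : ℕ) : ℝ) ^ (-α⁻¹) * a j ^ α⁻¹) N f x)
        (∑ j ∈ Finset.Icc N.1.1 N.1.2, (v j : ℂ) * (P m (a (j + 1)) - P m (a j))) := by
      have h := hasSum_sum (s := Finset.Icc N.1.1 N.1.2) fun j _ =>
        ((hasSum_mul_heat hα0 hα1 (Nat.le_add_left 1 m) (hw0 m) (hw00 m) (hw m) (ha (j + 1)) hf
          x).sub (hasSum_mul_heat hα0 hα1 (Nat.le_add_left 1 m) (hw0 m) (hw00 m) (hw m) (ha j) hf
          x)).mul_left (v j : ℂ)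
      refine (funext fun i => ?_ : (fun i => _) = _) ▸ h
      unfold heatDiffTransform
      rw [Finset.mul_sum]
      exact Finset.sum_congr rfl fun j _ => by ring
    rw [← hsum.tsum_eq]
    refine enorm_tsum_le_tsum_enorm.trans (ENNReal.tsum_le_tsum fun i => ?_)
    rw [enorm_mul, ← ofReal_norm (Complex.ofReal _), Complex.norm_real,
      Real.norm_of_nonneg (hw0 m i)]
    gcongr
    exact le_iSup (fun N : {N : ℤ × ℤ // N.1 < N.2} => ‖heatDiffTransform v
      (fun j => i * ((m + 1 : ℕ) : ℝ) ^ (-α⁻¹) * a j ^ α⁻¹) N f x‖ₑ) N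

end Subordination

/-! ### Transfer to the fractional semigroup and conclusion. -/

/-- Fatou's lemma followed by Tonelli: each term of a mixture is bounded by `K` because its rescaled
times are again positive and increasing, and the weights sum to at most one. -/
theorem setLIntegral_maxDiffTransform_le {n : ℕ} [Nontrivial (EuclideanSpace ℝ (Fin n))] {α : ℝ}
    (hα0 : 0 < α) (hα1 : α < 1) {v a : ℤ → ℝ} (ha : ∀ j, 0 < a j) (hmon : Monotone a)
    {f : EuclideanSpace ℝ (Fin n) → ℂ} (hf : Integrable f) {B : Set (EuclideanSpace ℝ (Fin n))}
    {K : ℝ≥0∞} (hK : ∀ b : ℤ → ℝ, (∀ j, 0 < b j) → Monotone b →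
      ∫⁻ x in B, maxHeatDiffTransform v b f x ≤ K) :
    ∫⁻ x in B, maxDiffTransform α v a f x ≤ K := by
  obtain ⟨w, hw0, hw00, hw1, hw⟩ := exists_maxDiffTransform_le_liminf (n := n) hα0 hα1
  set b : ℕ → ℕ → ℤ → ℝ := fun m i j => i * ((m + 1 : ℕ) : ℝ) ^ (-α⁻¹) * a j ^ α⁻¹ with hb
  have hδ : ∀ m : ℕ, 0 < ((m + 1 : ℕ) : ℝ) ^ (-α⁻¹) := fun m =>
    Real.rpow_pos_of_pos (by positivity) _
  have hb0 : ∀ m i, 0 < i → ∀ j, 0 < b m i j := fun m i hi j =>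
    mul_pos (mul_pos (by exact_mod_cast hi) (hδ m)) (Real.rpow_pos_of_pos (ha j) _)
  have hbm : ∀ m i, Monotone (b m i) := fun m i j k hjk =>
    mul_le_mul_of_nonneg_left (Real.rpow_le_rpow (ha j).le (hmon hjk) (by positivity))
      (mul_nonneg (Nat.cast_nonneg _) (hδ m).le)
  have hmeas : ∀ m i, Measurable fun x => ENNReal.ofReal (w m i) *
      maxHeatDiffTransform v (b m i) f x := by
    intro m i
    rcases Nat.eq_zero_or_pos i with rfl | hi
    · simp only [hw00, ENNReal.ofReal_zero, zero_mul]
      exact measurable_const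
    · exact (measurable_maxHeatDiffTransform v (hb0 m i hi) hf).const_mul _
  calc ∫⁻ x in B, maxDiffTransform α v a f x
      ≤ ∫⁻ x in B, Filter.liminf (fun m : ℕ => ∑' i : ℕ, ENNReal.ofReal (w m i) *
          maxHeatDiffTransform v (b m i) f x) Filter.atTop :=
        lintegral_mono fun x => hw v a ha f hf x
    _ ≤ Filter.liminf (fun m : ℕ => ∫⁻ x in B, ∑' i : ℕ, ENNReal.ofReal (w m i) *
          maxHeatDiffTransform v (b m i) f x) Filter.atTop :=
        lintegral_liminf_le fun m => Measurable.tsum fun i => hmeas m i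
    _ ≤ K := by
        refine (Filter.liminf_le_liminf (Filter.Eventually.of_forall fun m => ?_)).trans_eq
          (Filter.liminf_const (f := Filter.atTop (α := ℕ)) K)
        rw [lintegral_tsum fun i => (hmeas m i).aemeasurable]
        calc ∑' i : ℕ, ∫⁻ x in B, ENNReal.ofReal (w m i) * maxHeatDiffTransform v (b m i) f x
            ≤ ∑' i : ℕ, ENNReal.ofReal (w m i) * K := by
              refine ENNReal.tsum_le_tsum fun i => ?_
              rcases Nat.eq_zero_or_pos i with rfl | hi
              · simp [hw00]
              · rw [lintegral_const_mul' _ _ ENNReal.ofReal_ne_top]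
                gcongr
                exact hK _ (hb0 m i hi) (hbm m i)
          _ = (∑' i : ℕ, ENNReal.ofReal (w m i)) * K := ENNReal.tsum_mul_right
          _ ≤ 1 * K := by gcongr; exact hw1 m
          _ = K := one_mul K

theorem theorem1p2 (n : ℕ) (hn : 1 ≤ n) (α : ℝ) (hα0 : 0 < α) (hα1 : α < 1) :
    ∃ C : ℝ, 0 < C ∧
      ∀ (p p' : ℝ≥0∞) (_ : 1 ≤ p) (_ : ENNReal.HolderConjugate p p')
        (v : lp (fun _ : ℤ => ℝ) p)
        (a : ℤ → ℝ) (_ : ∀ j, 0 < a j) (_ : Monotone a)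
        (f : EuclideanSpace ℝ (Fin n) → ℂ) (_ : MemLp f ∞ volume)
        (_ : ∀ᵐ x ∂volume, x ∉ Metric.ball (0 : EuclideanSpace ℝ (Fin n)) 1 → f x = 0)
        (z : EuclideanSpace ℝ (Fin n)) (r : ℝ) (_ : 0 < r) (_ : 2 * r < 1)
        (_ : Metric.ball z r ⊆ Metric.ball (0 : EuclideanSpace ℝ (Fin n)) 1),
        (volume (Metric.ball z r))⁻¹ *
            ∫⁻ x in Metric.ball z r, maxDiffTransform α (fun j => v j) a f x
          ≤ ENNReal.ofReal (C * Real.log (2 / r) ^ (1 / p').toReal * ‖v‖) *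
              eLpNorm f ∞ volume := by
  have : Nonempty (Fin n) := ⟨⟨0, hn⟩⟩
  set C := heatMaxConst (Module.finrank ℝ (EuclideanSpace ℝ (Fin n)))
    (volume.real (Metric.ball (0 : EuclideanSpace ℝ (Fin n)) 1)) with hC
  refine ⟨C, heatMaxConst_pos _ _, ?_⟩
  intro p p' hp hpp' v a ha hmon f hf hfB z r hr hr2 hball
  have hfi : Integrable f :=
    IntegrableOn.integrable_of_ae_notMem_eq_zero (s := Metric.ball 0 1)
      (by
        have : IsFiniteMeasure (volume.restrict
            (Metric.ball (0 : EuclideanSpace ℝ (Fin n)) 1)) :=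
          isFiniteMeasure_restrict.2 measure_ball_lt_top.ne
        exact (hf.restrict _).integrable le_top) hfB
  set A := (eLpNorm f ∞ volume).toReal with hA
  have hAe : eLpNorm f ∞ volume = ENNReal.ofReal A := (ENNReal.ofReal_toReal hf.2.ne).symm
  have hfA : ∀ᵐ y, ‖f y‖ ≤ A := by
    filter_upwards [ae_le_eLpNormEssSup (f := f) (μ := volume)] with y hy
    rw [← eLpNorm_exponent_top, hAe, ← ofReal_norm] at hy
    exact (ENNReal.ofReal_le_ofReal_iff ENNReal.toReal_nonneg).1 hy
  rcases (lp.norm_nonneg' v).eq_or_lt with hv | hv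
  · have hv0 : v = 0 := lp.norm_eq_zero_iff.1 hv.symm
    have h0 : ∀ x, maxDiffTransform α (fun j => v j) a f x = 0 := by
      intro x
      simp [maxDiffTransform, diffTransform, hv0]
    simp [h0]
  rcases (ENNReal.toReal_nonneg : 0 ≤ A).eq_or_lt with hA0 | hA0
  -- The heat estimate needs `A > 0`. For `A = 0` the transform vanishes at every point, not just
  -- almost everywhere, because it depends on `f` only through `𝓕 f`.
  · have hf0 : f =ᵐ[volume] 0 := by
      filter_upwards [hfA] with y hy
      exact norm_le_zero_iff.1 (hy.trans_eq hA0.symm)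
    have hF : 𝓕 f = 0 := by
      ext ξ
      rw [Real.fourier_congr_ae hf0]
      simp [Real.fourier_eq]
    have h0 : ∀ x, maxDiffTransform α (fun j => v j) a f x = 0 := by
      intro x
      simp [maxDiffTransform, diffTransform, fracHeat, hF, Real.fourierInv_eq]
    simp [h0]
  have hmain := setLIntegral_maxDiffTransform_le hα0 hα1 ha hmon hfi (B := Metric.ball z r)
    (v := fun j => v j) fun b hb0 hbm =>
      setLIntegral_maxHeatDiffTransform_le hp hpp' v hv hb0 hbm hfi hA0 hfA hfB hr hr2 hball
  have hm0 : volume (Metric.ball z r) ≠ 0 := (Metric.measure_ball_pos _ _ hr).ne'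
  have hmt : volume (Metric.ball z r) ≠ ∞ := measure_ball_lt_top.ne
  rw [hAe, ← ENNReal.ofReal_mul' hA0.le]
  calc _ ≤ _ := mul_le_mul_right hmain _
    _ = _ := by
        rw [mul_left_comm, ENNReal.inv_mul_cancel hm0 hmt, mul_one]
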